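/- Let $G$ be a countable infinite discrete group. Let $(F_n)_{n\ge 0}$ and $(C_n)_{n\ge 1}$ be sequences of finite subsets of $G$ such that (I) $F_0=\{1\}$ and $\#C_n>1$ for all $n\ge 1$; (II) $F_nC_{n+1}\subset F_{n+1}$ for all $n\ge 0$; (III) $F_nc\cap F_nc'=\emptyset$ for all $n\ge 0$ and all distinct $c,c'\in C_{n+1}$. Let $X_n=F_n\times C_{n+1}\times C_{n+2}\times\cdots$ with the product topology, and let $X$ be the inductive limit of the spaces $X_n$ under the embeddings $X_n\ni(f_n,c_{n+1},c_{n+2},\dots)\mapsto(f_nc_{n+1},c_{n+2},\dots)\in X_{n+1}$. Let $\mu$ be the Borel measure on $X$ with $\mu(\{(f_n,c_{n+1},\dots)\in X_n: f_n\in A\})=\#A/(\#C_1\cdots\#C_n)$ for all $n\ge 0$ and $A\subset F_n$. For $g\in G$ let $X^g$ be the set of those $x\in X$ which, for some $n$, have the form $x=(f_n,c_{n+1},\dots)\in X_n$ with $gf_n\in F_n$; put $X^G=\bigcap_{g\in G}X^g$. The $(C,F)$-action $T=(T_g)_{g\in G}$ associated with $(C_n,F_{n-1})_{n\ge1}$ is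 the action of $G$ on $(X^G,\mu|_{X^G})$ given by $T_g(f_n,c_{n+1},\dots)=(gf_n,c_{n+1},\dots)\in X_n$ whenever $f_n,gf_n\in F_n$. Consider the conditions (1-2) for each $g\in G$ and $n>0$ there is $m>n$ such that $gF_nC_{n+1}C_{n+2}\cdots C_m\subset F_m$; (1-3) for each $g\in G$ and $n>0$, $\displaystyle\lim_{m\to\infty}\frac{\#\big((gF_nC_{n+1}C_{n+2}\cdots C_m)\cap F_m\big)}{\#F_n\,\#C_{n+1}\cdots\#C_m}=1$. Two measure preserving actions of $G$ on $(Y,\mu)$ and $(Z,\nu)$ are called isomorphic if there is a $G$-equivariant bimeasurable bijection between $G$-invariant conull measurable subsets of $Y$ and $Z$ which carries $\mu$ to $c\,\nu$ for some constant $0<c<\infty$. An action of $G$ on $(Y,\mu)$, where $G=\mathbb Z$, is of rank one if there are measurable sets $B_n$ of finite measure and intervals $I_n=\{0,1,\dots,N_n-1\}$, $n\ge 0$, such that for each $n$ the sets $T_jB_n$, $j\in I_n$, are pairwise disjoint, and $\lim_{n\to\infty}\min_{J\subset I_n}\mu\big(B\,\triangle\,\bigsqcup_{j\in J}T_jB_n\big)=0$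 for each measurable $B$ of finite measure. **Theorem 1.8.** Let $T$ be the $(C,F)$-action of $G$ associated with a sequence $(C_n,F_{n-1})_{n\ge1}$ satisfying (I)–(III) and (1-3); then $\mu(X\setminus X^G)=0$, so that $T$ is defined almost everywhere on $X$. There is a sequence $(C_n',F_{n-1}')_{n\ge1}$ satisfying (I)–(III) and (1-2) such that $(F_n')_{n\ge0}$ is a subsequence of $(F_n)_{n\ge0}$, the associated $(C,F)$-action $S$ is defined everywhere on its $(C,F)$-space, and $T$ is isomorphic to $S$. In particular, if $G=\mathbb Z$ and $T$ is of rank one, then $S$ is also of rank one. -/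

import Mathlib

open scoped Pointwise ENNReal symmDiff
open MeasureTheory Filter Topology

noncomputable section

/-- The defining data of a `(C,F)`-action of `G`: finite subsets `F n` (`n ≥ 0`) and `C n` (`n ≥ 1`)
of `G` subject to the three standing conditions. The value `C 0` plays no role. -/
structure CFSequence (G : Type*) [Group G] where
  F : ℕ → Finset G
  C : ℕ → Finset G
  F_zero : F 0 = {1}
  one_lt_card : ∀ n, 1 < (C (n + 1)).card
  mul_subset : ∀ n, (F n : Set G) * (C (n + 1) : Set G) ⊆ (F (n + 1) : Set G)
  disjoint : ∀ n, ∀ c ∈ C (n + 1), ∀ c' ∈ C (n + 1), c ≠ c' →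
    Disjoint ((F n : Set G) * {c}) ((F n : Set G) * {c'})

namespace CFSequence

variable {G : Type*} [Group G] (S : CFSequence G)

/-- `S.prodSet n k` is the product set `F n * C (n+1) * ⋯ * C (n+k)`. -/
def prodSet (n : ℕ) : ℕ → Set G
  | 0 => (S.F n : Set G)
  | k + 1 => prodSet n k * (S.C (n + k + 1) : Set G)

/-- For all `g` and `n > 0` there is `m = n + k > n` with `g F_n C_{n+1} ⋯ C_m ⊆ F_m`. -/
def EverywhereDefined : Prop :=
  ∀ (g : G) (n : ℕ), 0 < n → ∃ k, 0 < k ∧ g • S.prodSet n k ⊆ (S.F (n + k) : Set G)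

/-- For all `g` and `n > 0`, the ratio
`#(g F_n C_{n+1} ⋯ C_m ∩ F_m) / (#F_n #C_{n+1} ⋯ #C_m)`, where `m = n + k`, tends to `1`. -/
def AEDefined : Prop :=
  ∀ (g : G) (n : ℕ), 0 < n →
    Tendsto (fun k : ℕ => ((g • S.prodSet n k ∩ (S.F (n + k) : Set G)).ncard : ℝ) /
      ((S.F n).card * ∏ i ∈ Finset.range k, (S.C (n + i + 1)).card : ℕ)) atTop (𝓝 1)

/-- The set of admissible values of the `i`-th coordinate of a point of `X_n`: a point
`(f_n, c_{n+1}, c_{n+2}, …)` of `X_n = F_n × C_{n+1} × C_{n+2} × ⋯` is stored as the sequence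
`(1, …, 1, f_n, c_{n+1}, c_{n+2}, …)` with `f_n` in position `n`. -/
def digits (n i : ℕ) : Finset G :=
  if i < n then {1} else if i = n then S.F n else S.C i

/-- The space `X_n = F_n × C_{n+1} × C_{n+2} × ⋯`. -/
def Level (n : ℕ) : Type _ := {x : ℕ → G // ∀ i, x i ∈ S.digits n i}

/-- The infinite product topology on `X_n`, the factors being discrete. -/
instance (n : ℕ) : TopologicalSpace (S.Level n) :=
  letI : TopologicalSpace G := ⊥
  inferInstanceAs (TopologicalSpace {x : ℕ → G // ∀ i, x i ∈ S.digits n i})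

/-- The product σ-algebra on `X_n`, the factors being discrete. -/
instance (n : ℕ) : MeasurableSpace (S.Level n) :=
  letI : MeasurableSpace G := ⊤
  inferInstanceAs (MeasurableSpace {x : ℕ → G // ∀ i, x i ∈ S.digits n i})

end CFSequence

/-- The product `x 0 * x 1 * ⋯ * x k`. -/
def partialProd {G : Type*} [Group G] (x : ℕ → G) : ℕ → G
  | 0 => x 0
  | k + 1 => partialProd x k * x (k + 1)

namespace CFSequence

variable {G : Type*} [Group G] (S : CFSequence G)

/-- Under the embeddings
`X_n → X_{n+1}, (f_n, c_{n+1}, c_{n+2}, …) ↦ (f_n c_{n+1}, c_{n+2}, …)`, the image in `X_k` (`n ≤ k`)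
of a point `x = (f_n, c_{n+1}, …)` of `X_n` is `(f_n c_{n+1} ⋯ c_k, c_{k+1}, c_{k+2}, …)`.
`S.Rel p q` says that `p ∈ X_n` and `q ∈ X_m` have the same image in `X_k` for some `k ≥ n, m`. -/
def Rel (p q : Σ n, S.Level n) : Prop :=
  ∃ k, p.1 ≤ k ∧ q.1 ≤ k ∧ partialProd p.2.1 k = partialProd q.2.1 k ∧
    ∀ i, k < i → p.2.1 i = q.2.1 i

theorem partialProd_eq_of_le {x y : ℕ → G} {k l : ℕ} (hkl : k ≤ l)
    (h : partialProd x k = partialProd y k) (ht : ∀ i, k < i → x i = y i) :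
    partialProd x l = partialProd y l := by
  induction l, hkl using Nat.le_induction with
  | base => exact h
  | succ l hl ih => simp only [partialProd, ih, ht (l + 1) (by omega)]

/-- The equivalence relation on the disjoint union of the `X_n` whose quotient is the inductive limit. -/
def setoid : Setoid (Σ n, S.Level n) where
  r := S.Rel
  iseqv := by
    refine ⟨fun p => ⟨p.1, le_rfl, le_rfl, rfl, fun _ _ => rfl⟩, ?_, ?_⟩
    · rintro p q ⟨k, h1, h2, h3, h4⟩
      exact ⟨k, h2, h1, h3.symm, fun i hi => (h4 i hi).symm⟩
    · rintro p q r ⟨k, h1, h2, h3, h4⟩ ⟨l, h5, h6, h7, h8⟩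
      refine ⟨max k l, by omega, by omega, ?_, fun i hi => ?_⟩
      · exact (partialProd_eq_of_le (le_max_left k l) h3 h4).trans
          (partialProd_eq_of_le (le_max_right k l) h7 h8)
      · exact (h4 i (by omega)).trans (h8 i (by omega))

/-- The `(C,F)`-space `X`: the inductive limit of the spaces `X_n`. -/
def Space : Type _ := Quotient S.setoid

/-- The inductive limit topology. -/
instance : TopologicalSpace S.Space :=
  inferInstanceAs (TopologicalSpace (Quotient S.setoid))

instance : MeasurableSpace S.Space := borel S.Space

instance : BorelSpace S.Space := ⟨rfl⟩

/-- The canonical map `X_n → X`. -/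
def toSpace (n : ℕ) (x : S.Level n) : S.Space := Quotient.mk S.setoid ⟨n, x⟩

/-- `X_n` as a subset of `X`. -/
def levelSet (n : ℕ) : Set S.Space := Set.range (S.toSpace n)

/-- The product probability measure on `X_n` each of whose factors is equidistributed on the
corresponding finite set. -/
def levelProb (n : ℕ) : Measure (S.Level n) :=
  letI : MeasurableSpace G := ⊤
  (Measure.infinitePi fun i => ProbabilityTheory.uniformOn (S.digits n i : Set G)).comap
    (Subtype.val : {x : ℕ → G // ∀ i, x i ∈ S.digits n i} → ℕ → G)

/-- The restriction of the `(C,F)`-measure to `X_n`: it has total mass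
`#F_n / (#C_1 ⋯ #C_n)`, so that the cylinder `[A]_n` has mass `#A / (#C_1 ⋯ #C_n)`. -/
def levelMeasure (n : ℕ) : Measure S.Space :=
  (((S.F n).card : ℝ≥0∞) / (∏ i ∈ Finset.range n, (S.C (i + 1)).card : ℕ)) •
    (S.levelProb n).map (S.toSpace n)

/-- The `(C,F)`-measure `μ` on `X`: on each set `X_n \ (X_0 ∪ ⋯ ∪ X_{n-1})` it is given
by `levelMeasure n`. -/
def measure : Measure S.Space :=
  Measure.sum fun n => (S.levelMeasure n).restrict (⋃ m < n, S.levelSet m)ᶜ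

/-- `X^g`: the points having a representative `(f_n, c_{n+1}, …) ∈ X_n` with `g f_n ∈ F_n`. -/
def domainOf (g : G) : Set S.Space :=
  {p | ∃ (n : ℕ) (x : S.Level n), S.toSpace n x = p ∧ g * x.1 n ∈ S.F n}

/-- `X^G = ⋂ X^g`, the set on which the `(C,F)`-action is defined. -/
def domain : Set S.Space := ⋂ g : G, S.domainOf g

variable {S}

/-- `(f_n, c_{n+1}, …) ↦ (g f_n, c_{n+1}, …)` -/
def translate {n : ℕ} (g : G) (x : S.Level n) (h : g * x.1 n ∈ S.F n) : S.Level n :=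
  ⟨Function.update x.1 n (g * x.1 n), fun i => by
    by_cases hi : i = n
    · subst hi; simpa [digits] using h
    · simpa [Function.update_of_ne hi] using x.2 i⟩

theorem partialProd_of_lt {n k : ℕ} (x : S.Level n) (h : k < n) : partialProd x.1 k = 1 := by
  have h1 : ∀ i < n, x.1 i = 1 := fun i hi => by simpa [digits, hi] using x.2 i
  induction k with
  | zero => exact h1 0 h
  | succ k ih => simp only [partialProd, ih (by omega), h1 _ h, mul_one]

theorem partialProd_self {n : ℕ} (x : S.Level n) : partialProd x.1 n = x.1 n := by
  cases n with
  | zero => rfl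
  | succ n => simp only [partialProd, partialProd_of_lt x (Nat.lt_succ_self n), one_mul]

theorem partialProd_translate {n k : ℕ} (g : G) (x : S.Level n) (h : g * x.1 n ∈ S.F n)
    (hk : n ≤ k) : partialProd (translate g x h).1 k = g * partialProd x.1 k := by
  induction k, hk using Nat.le_induction with
  | base => rw [partialProd_self, partialProd_self]; simp [translate]
  | succ k hk ih =>
    simp only [partialProd, ih, mul_assoc]
    simp [translate, Function.update_of_ne (show k + 1 ≠ n by omega)]

theorem mul_partialProd_mem {n k : ℕ} (g : G) (x : S.Level n) (h : g * x.1 n ∈ S.F n)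
    (hk : n ≤ k) : g * partialProd x.1 k ∈ S.F k := by
  induction k, hk using Nat.le_induction with
  | base => rwa [partialProd_self]
  | succ k hk ih =>
    have h1 := x.2 (k + 1)
    simp only [digits, show ¬ k + 1 < n by omega, show k + 1 ≠ n by omega, if_false] at h1
    rw [partialProd, ← mul_assoc]
    exact S.mul_subset k (Set.mul_mem_mul ih h1)

theorem toSpace_eq_iff {n m : ℕ} {x : S.Level n} {y : S.Level m} :
    S.toSpace n x = S.toSpace m y ↔ S.Rel ⟨n, x⟩ ⟨m, y⟩ :=
  ⟨fun h => Quotient.exact h, fun h => Quotient.sound h⟩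

theorem toSpace_translate_eq {n m : ℕ} {x : S.Level n} {y : S.Level m} (g : G)
    (hx : g * x.1 n ∈ S.F n) (hy : g * y.1 m ∈ S.F m) (h : S.toSpace n x = S.toSpace m y) :
    S.toSpace n (translate g x hx) = S.toSpace m (translate g y hy) := by
  obtain ⟨k, h1, h2, h3, h4⟩ := toSpace_eq_iff.1 h
  refine toSpace_eq_iff.2 ⟨k, h1, h2, ?_, fun i hi => ?_⟩
  · dsimp only at h1 h2 h3 ⊢
    rw [partialProd_translate g x hx h1, partialProd_translate g y hy h2, h3]
  · dsimp only at h1 h2 h4 ⊢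
    simp only [translate, Function.update_of_ne (show i ≠ n by omega),
      Function.update_of_ne (show i ≠ m by omega)]
    exact h4 i hi

/-- The image of `x ∈ X_n` in `X_k`, `n ≤ k`. -/
def push {n : ℕ} (x : S.Level n) (k : ℕ) (hk : n ≤ k) : S.Level k :=
  ⟨fun i => if i < k then 1 else if i = k then partialProd x.1 k else x.1 i, fun i => by
    have hx : 1 * x.1 n ∈ S.F n := by simpa [digits] using x.2 n
    rcases lt_trichotomy i k with h | rfl | h
    · simp [digits, h]
    · simpa [digits] using mul_partialProd_mem 1 x hx hk
    · have := x.2 i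
      simpa [digits, show ¬ i < k by omega, show ¬ i < n by omega, show i ≠ k by omega,
        show i ≠ n by omega] using this⟩

theorem push_apply_self {n : ℕ} (x : S.Level n) (k : ℕ) (hk : n ≤ k) :
    (push x k hk).1 k = partialProd x.1 k := by simp [push]

theorem toSpace_push {n : ℕ} (x : S.Level n) (k : ℕ) (hk : n ≤ k) :
    S.toSpace k (push x k hk) = S.toSpace n x := by
  refine toSpace_eq_iff.2 ⟨k, le_rfl, hk, ?_, fun i hi => ?_⟩
  · dsimp only
    rw [partialProd_self, push_apply_self]
  · simp [push, show ¬ i < k by omega, show i ≠ k by omega]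

theorem exists_common {p : S.Space} {g h : G} (hg : p ∈ S.domainOf g) (hh : p ∈ S.domainOf h) :
    ∃ (k : ℕ) (z : S.Level k), S.toSpace k z = p ∧ g * z.1 k ∈ S.F k ∧ h * z.1 k ∈ S.F k := by
  obtain ⟨n, x, rfl, hx⟩ := hg
  obtain ⟨m, y, hxy, hy⟩ := hh
  obtain ⟨k, h1, h2, h3, -⟩ := toSpace_eq_iff.1 hxy
  refine ⟨k, push x k h2, toSpace_push x k h2, ?_, ?_⟩
  · rw [push_apply_self]; exact mul_partialProd_mem g x hx h2
  · rw [push_apply_self, ← h3]; exact mul_partialProd_mem h y hy h1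

/-- `T_g (f_n, c_{n+1}, …) = (g f_n, c_{n+1}, …)` for any representative with `g f_n ∈ F_n`; the
result does not depend on the representative by `toSpace_translate_eq`. -/
def act (g : G) (p : S.Space) (hp : p ∈ S.domainOf g) : S.Space :=
  S.toSpace hp.choose (translate g hp.choose_spec.choose hp.choose_spec.choose_spec.2)

theorem act_eq {g : G} {p : S.Space} (hp : p ∈ S.domainOf g) {n : ℕ} {x : S.Level n}
    (hx : S.toSpace n x = p) (h : g * x.1 n ∈ S.F n) :
    act g p hp = S.toSpace n (translate g x h) :=
  toSpace_translate_eq g _ h (hp.choose_spec.choose_spec.1.trans hx.symm)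

theorem act_mem {g h : G} {p : S.Space} (hp : p ∈ S.domainOf g) (hp' : p ∈ S.domainOf (h * g)) :
    ∃ H : act g p hp ∈ S.domainOf h, act h (act g p hp) H = act (h * g) p hp' := by
  obtain ⟨k, z, rfl, h1, h2⟩ := exists_common hp hp'
  have h3 : h * (translate g z h1).1 k ∈ S.F k := by simpa [translate, mul_assoc] using h2
  have H : act g _ hp ∈ S.domainOf h := ⟨k, translate g z h1, (act_eq hp rfl h1).symm, h3⟩
  refine ⟨H, ?_⟩
  rw [act_eq H (act_eq hp rfl h1).symm h3, act_eq hp' rfl h2]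
  congr 1
  apply Subtype.ext
  simp [translate, mul_assoc]

/-- The `(C,F)`-action `T` of `G` on `X^G`. -/
instance : MulAction G S.domain where
  smul g p := ⟨act g p.1 (Set.mem_iInter.1 p.2 g), Set.mem_iInter.2 fun h =>
    (act_mem (Set.mem_iInter.1 p.2 g) (Set.mem_iInter.1 p.2 (h * g))).1⟩
  one_smul p := by
    apply Subtype.ext
    obtain ⟨n, x, hx, h⟩ := Set.mem_iInter.1 p.2 1
    change act 1 p.1 _ = p.1
    rw [act_eq _ hx h, ← hx]
    congr 1
    apply Subtype.ext
    simp [translate]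
  mul_smul h g p := Subtype.ext
    (act_mem (Set.mem_iInter.1 p.2 g) (Set.mem_iInter.1 p.2 (h * g))).2.symm

variable (S)

/-- The `(C,F)`-measure, considered on the set `X^G` on which the action is defined. -/
def domainMeasure : Measure S.domain := S.measure.comap Subtype.val

end CFSequence

/-- Measure theoretic isomorphism of two actions of `G` on measure spaces: an equivariant
bimeasurable bijection between invariant conull measurable subsets which carries `μ` to a
positive finite multiple of `ν`. -/
def MeasureIsomorphic (G : Type*) [Group G] {X Y : Type*} [MeasurableSpace X] [MeasurableSpace Y]
    [MulAction G X] [MulAction G Y] (μ : Measure X) (ν : Measure Y) : Prop :=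
  ∃ (A : Set X) (B : Set Y) (hA : ∀ (g : G), ∀ x ∈ A, g • x ∈ A) (φ : A ≃ᵐ B) (c : ℝ≥0∞),
    MeasurableSet A ∧ MeasurableSet B ∧ μ Aᶜ = 0 ∧ ν Bᶜ = 0 ∧
    (∀ (g : G) (x : A), (φ ⟨g • x.1, hA g x.1 x.2⟩ : Y) = g • (φ x : Y)) ∧
    c ≠ 0 ∧ c ≠ ∞ ∧
    (μ.comap (Subtype.val : A → X)).map φ = c • ν.comap (Subtype.val : B → Y)

/-- The action of `G`, which is identified with `ℤ` by means of `e`, is of rank one: there are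
measurable sets `B n` of finite measure and intervals `{0, 1, …, N n - 1}` such that, for each `n`,
the sets `T_j (B n)`, `0 ≤ j < N n`, are pairwise disjoint, and every measurable set of finite
measure is approximated by unions of these sets as `n → ∞`. -/
def IsRankOne {G : Type*} [Group G] (e : Multiplicative ℤ ≃* G) {X : Type*} [MeasurableSpace X]
    [MulAction G X] (μ : Measure X) : Prop :=
  ∃ (B : ℕ → Set X) (N : ℕ → ℕ),
    (∀ n, MeasurableSet (B n) ∧ μ (B n) < ∞) ∧
    (∀ n, ∀ i < N n, ∀ j < N n, i ≠ j →
      Disjoint (e (Multiplicative.ofAdd (i : ℤ)) • B n) (e (Multiplicative.ofAdd (j : ℤ)) • B n)) ∧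
    ∀ A : Set X, MeasurableSet A → μ A < ∞ →
      Tendsto (fun n => ⨅ J ∈ (Finset.range (N n)).powerset,
        μ (A ∆ ⋃ j ∈ J, e (Multiplicative.ofAdd (j : ℤ)) • B n)) atTop (𝓝 0)

end

/-! By (1-3), for fixed `g` and `n`, most `d` in `C_{n+1} ⋯ C_m` satisfy `g F_n d ⊆ F_m` once `m` is
large. So pass to levels `0 = κ 0 < κ 1 < ⋯`, put `F'_n = F_{κ n}`, and take `C'_{n+1}` inside `C_{κ
n + 1} ⋯ C_{κ (n+1)}` so that, for `n > 0`, its elements are good for the first `n + 1` members of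
an enumeration of `G` (`AEDefined.exists_next`). Every `g` is eventually listed, which forces (1-2)
(`AEDefined.exists_isThinning`). Discarding at most the proportion `2^{-(n+2)}` at step `n` makes
`#C'_1 ⋯ #C'_n / (#C_1 ⋯ #C_{κ n})` converge to some `0 < c < ∞` (`IsThinning.exists_tendsto`).

A point is a coherent sequence of cylinders. Reading the cylinders of the new space in the old one
gives an equivariant embedding `IsThinning.lift`, and the old measure of an image is `c` times the
new measure, because the image of a cylinder is a decreasing intersection of finite unions of
cylinders (`IsThinning.image_lift_cyl`). The range is conull
(`IsThinning.measure_compl_range_lift`): as `F'_j` is all of `F_{κ j}`, an old cylinder contains the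
images of enough new cylinders to fill its mass in the limit. Since the new action is defined
everywhere, the range lies in `X^G`; this gives both the nullity of the complement of `X^G` and the
isomorphism. Rank one is an isomorphism invariant. -/

namespace CFSequence

variable {G : Type*} [Group G] (S : CFSequence G)

/-! ### Unique factorization in the product sets `C (m+1) * ⋯ * C n`. -/

theorem card_C_pos (n : ℕ) : 0 < (S.C (n + 1)).card := (Nat.zero_lt_one).trans (S.one_lt_card n)

theorem nonempty_C (n : ℕ) : (S.C (n + 1)).Nonempty := Finset.card_pos.1 (S.card_C_pos n)

variable {S}

theorem mul_mem_F {n : ℕ} {a c : G} (ha : a ∈ S.F n) (hc : c ∈ S.C (n + 1)) :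
    a * c ∈ S.F (n + 1) :=
  S.mul_subset n (Set.mul_mem_mul ha hc)

variable (S) in
theorem nonempty_F (n : ℕ) : (S.F n).Nonempty := by
  induction n with
  | zero => rw [S.F_zero]; exact Finset.singleton_nonempty 1
  | succ n ih =>
    obtain ⟨a, ha⟩ := ih
    obtain ⟨c, hc⟩ := S.nonempty_C n
    exact ⟨_, mul_mem_F ha hc⟩

theorem eq_of_mul_eq {n : ℕ} {a b c d : G} (ha : a ∈ S.F n) (hb : b ∈ S.F n)
    (hc : c ∈ S.C (n + 1)) (hd : d ∈ S.C (n + 1)) (h : a * c = b * d) : a = b ∧ c = d := by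
  have hcd : c = d := by
    by_contra hne
    refine Set.disjoint_left.1 (S.disjoint n c hc d hd hne) (Set.mul_mem_mul ha rfl) ?_
    rw [h]
    exact Set.mul_mem_mul hb rfl
  subst hcd
  exact ⟨mul_right_cancel h, rfl⟩

open scoped Classical in
variable (S) in
/-- The product set `C (m+1) * ⋯ * C n`, which is `{1}` if `n ≤ m`. -/
noncomputable def block (m : ℕ) : ℕ → Finset G
  | 0 => {1}
  | n + 1 => if m ≤ n then block m n * S.C (n + 1) else {1}

theorem block_self (m : ℕ) : S.block m m = {1} := by
  cases m with
  | zero => rfl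
  | succ m => simp [block]

theorem mem_block_self {m : ℕ} {d : G} : d ∈ S.block m m ↔ d = 1 := by simp [block_self]

theorem mem_block_succ {m n : ℕ} (h : m ≤ n) {d : G} :
    d ∈ S.block m (n + 1) ↔ ∃ e ∈ S.block m n, ∃ c ∈ S.C (n + 1), e * c = d := by
  simp [block, h, Finset.mem_mul]

theorem mul_block_mem_F {m n : ℕ} (h : m ≤ n) {a d : G} (ha : a ∈ S.F m)
    (hd : d ∈ S.block m n) : a * d ∈ S.F n := by
  induction n, h using Nat.le_induction generalizing d with
  | base => rw [mem_block_self.1 hd, mul_one]; exact ha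
  | succ n hn ih =>
    obtain ⟨e, he, c, hc, rfl⟩ := (mem_block_succ hn).1 hd
    rw [← mul_assoc]
    exact mul_mem_F (ih he) hc

theorem eq_of_mul_block_eq {m n : ℕ} (h : m ≤ n) {a b d e : G} (ha : a ∈ S.F m) (hb : b ∈ S.F m)
    (hd : d ∈ S.block m n) (he : e ∈ S.block m n) (hab : a * d = b * e) : a = b ∧ d = e := by
  have key : a = b := by
    induction n, h using Nat.le_induction generalizing d e with
    | base => simpa [mem_block_self.1 hd, mem_block_self.1 he] using hab
    | succ n hn ih =>
      obtain ⟨d, hd', c, hc, rfl⟩ := (mem_block_succ hn).1 hd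
      obtain ⟨e, he', c', hc', rfl⟩ := (mem_block_succ hn).1 he
      rw [← mul_assoc, ← mul_assoc] at hab
      exact ih hd' he'
        (eq_of_mul_eq (mul_block_mem_F hn ha hd') (mul_block_mem_F hn hb he') hc hc' hab).1
  subst key
  exact ⟨rfl, mul_left_cancel hab⟩

theorem mul_mem_block {l m n : ℕ} (h : l ≤ m) (h' : m ≤ n) {d e : G} (hd : d ∈ S.block l m)
    (he : e ∈ S.block m n) : d * e ∈ S.block l n := by
  induction n, h' using Nat.le_induction generalizing e with
  | base => rw [mem_block_self.1 he, mul_one]; exact hd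
  | succ n hn ih =>
    obtain ⟨e, he', c, hc, rfl⟩ := (mem_block_succ hn).1 he
    exact (mem_block_succ (h.trans hn)).2 ⟨_, ih he', c, hc, mul_assoc _ _ _⟩

theorem mem_block_one {n : ℕ} {c : G} (hc : c ∈ S.C (n + 1)) : c ∈ S.block n (n + 1) :=
  (mem_block_succ le_rfl).2 ⟨1, mem_block_self.2 rfl, c, hc, one_mul c⟩

variable (S) in
/-- The product `#C 1 ⋯ #C n`. -/
def vol (n : ℕ) : ℕ := ∏ i ∈ Finset.range n, (S.C (i + 1)).card

variable (S) in
theorem vol_pos (n : ℕ) : 0 < S.vol n := Finset.prod_pos fun i _ => S.card_C_pos i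

theorem vol_succ (n : ℕ) : S.vol (n + 1) = S.vol n * (S.C (n + 1)).card :=
  Finset.prod_range_succ _ n

theorem vol_mul_card_block {m n : ℕ} (h : m ≤ n) :
    S.vol m * (S.block m n).card = S.vol n := by
  classical
  induction n, h using Nat.le_induction with
  | base => simp [block_self]
  | succ n hn ih =>
    have : S.block m (n + 1) = S.block m n * S.C (n + 1) := by
      ext d; simp [mem_block_succ hn, Finset.mem_mul]
    rw [this, Finset.card_mul_iff.2, ← mul_assoc, ih, vol_succ]
    -- Multiplying on the left by an element of `F m` moves the products into `F n * C (n+1)`, where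
    -- factorization is unique.
    obtain ⟨a, ha⟩ := S.nonempty_F m
    rintro ⟨d, c⟩ ⟨hd, hc⟩ ⟨d', c'⟩ ⟨hd', hc'⟩ h
    simp only [Finset.mem_coe] at hd hc hd' hc'
    have := eq_of_mul_eq (mul_block_mem_F hn ha hd) (mul_block_mem_F hn ha hd') hc hc'
      (by rw [mul_assoc, mul_assoc]; exact congrArg _ h)
    exact Prod.ext (mul_left_cancel this.1) this.2

theorem card_block_add (n k : ℕ) :
    (S.block n (n + k)).card = ∏ i ∈ Finset.range k, (S.C (n + i + 1)).card := by
  have h := vol_mul_card_block (S := S) (Nat.le_add_right n k)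
  rw [vol, vol, Finset.prod_range_add] at h
  exact Nat.eq_of_mul_eq_mul_left (S.vol_pos n) h

theorem mem_prodSet {n k : ℕ} {a : G} :
    a ∈ S.prodSet n k ↔ ∃ f ∈ S.F n, ∃ d ∈ S.block n (n + k), f * d = a := by
  induction k generalizing a with
  | zero => simp [prodSet, block_self]
  | succ k ih =>
    simp only [prodSet, Set.mem_mul, ih, ← add_assoc, mem_block_succ (Nat.le_add_right n k)]
    constructor
    · rintro ⟨_, ⟨f, hf, d, hd, rfl⟩, c, hc, rfl⟩
      exact ⟨f, hf, _, ⟨d, hd, c, hc, rfl⟩, (mul_assoc _ _ _).symm⟩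
    · rintro ⟨f, hf, _, ⟨d, hd, c, hc, rfl⟩, rfl⟩
      exact ⟨_, ⟨f, hf, d, hd, rfl⟩, c, hc, mul_assoc _ _ _⟩

/-! ### Points of `X` and their cylinders. -/

theorem level_mem_F {n : ℕ} (x : S.Level n) : x.1 n ∈ S.F n := by
  simpa [digits] using x.2 n

theorem level_mem_C {n i : ℕ} (x : S.Level n) (h : n ≤ i) : x.1 (i + 1) ∈ S.C (i + 1) := by
  simpa [digits, show ¬ i + 1 < n by omega, show i + 1 ≠ n by omega] using x.2 (i + 1)

theorem level_eq_one {n i : ℕ} (x : S.Level n) (h : i < n) : x.1 i = 1 := by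
  simpa [digits, h] using x.2 i

theorem partialProd_mem {n k : ℕ} (x : S.Level n) (h : n ≤ k) : partialProd x.1 k ∈ S.F k := by
  simpa using mul_partialProd_mem 1 x (by simpa using level_mem_F x) h

theorem exists_partialProd_eq {n m k : ℕ} (x : S.Level n) (h : n ≤ m) (h' : m ≤ k) :
    ∃ d ∈ S.block m k, partialProd x.1 k = partialProd x.1 m * d := by
  induction k, h' using Nat.le_induction with
  | base => exact ⟨1, mem_block_self.2 rfl, (mul_one _).symm⟩
  | succ k hk ih =>
    obtain ⟨d, hd, h1⟩ := ih
    exact ⟨_, (mem_block_succ hk).2 ⟨d, hd, _, level_mem_C x (h.trans hk), rfl⟩, by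
      rw [partialProd, h1, mul_assoc]⟩

/-- Unique factorization peels off the last factor repeatedly, so the product forgets no coordinate.
-/
theorem level_eq_of_partialProd_eq {n k : ℕ} {x y : S.Level n} (hk : n ≤ k)
    (h : partialProd x.1 k = partialProd y.1 k) : ∀ i ≤ k, x.1 i = y.1 i := by
  induction k, hk using Nat.le_induction with
  | base =>
    intro i hi
    rcases hi.lt_or_eq with hi | rfl
    · rw [level_eq_one x hi, level_eq_one y hi]
    · rwa [partialProd_self, partialProd_self] at h
  | succ k hk ih =>
    obtain ⟨h1, h2⟩ := eq_of_mul_eq (partialProd_mem x hk) (partialProd_mem y hk)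
      (level_mem_C x hk) (level_mem_C y hk) h
    intro i hi
    rcases hi.lt_or_eq with hi | rfl
    · exact ih h1 i (by omega)
    · exact h2

theorem partialProd_congr {x y : ℕ → G} {k : ℕ} (h : ∀ i ≤ k, x i = y i) :
    partialProd x k = partialProd y k := by
  induction k with
  | zero => exact h 0 le_rfl
  | succ k ih => simp only [partialProd, ih fun i hi => h i (by omega), h (k + 1) le_rfl]

theorem toSpace_injective (n : ℕ) : Function.Injective (S.toSpace n) := by
  intro x y h
  obtain ⟨k, h1, -, h3, h4⟩ := toSpace_eq_iff.1 h
  refine Subtype.ext (funext fun i => ?_)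
  rcases le_or_gt i k with hi | hi
  · exact level_eq_of_partialProd_eq h1 h3 i hi
  · exact h4 i hi

variable (S) in
/-- The cylinder `[a]_n` of all points with a representative `(a, c_{n+1}, c_{n+2}, …) ∈ X_n`. -/
def cyl (n : ℕ) (a : G) : Set S.Space := {p | ∃ x : S.Level n, x.1 n = a ∧ S.toSpace n x = p}

theorem mem_F_of_mem_cyl {n : ℕ} {a : G} {p : S.Space} (h : p ∈ S.cyl n a) : a ∈ S.F n := by
  obtain ⟨x, rfl, -⟩ := h
  exact level_mem_F x

theorem toSpace_mem_cyl {n k : ℕ} (x : S.Level n) (h : n ≤ k) :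
    S.toSpace n x ∈ S.cyl k (partialProd x.1 k) :=
  ⟨push x k h, push_apply_self x k h, toSpace_push x k h⟩

theorem cyl_unique {n : ℕ} {a b : G} {p : S.Space} (ha : p ∈ S.cyl n a) (hb : p ∈ S.cyl n b) :
    a = b := by
  obtain ⟨x, rfl, rfl⟩ := ha
  obtain ⟨y, rfl, h⟩ := hb
  rw [toSpace_injective n h]

theorem toSpace_mem_cyl_iff {n k : ℕ} {x : S.Level n} (h : n ≤ k) {a : G} :
    S.toSpace n x ∈ S.cyl k a ↔ partialProd x.1 k = a :=
  ⟨fun ha => cyl_unique (toSpace_mem_cyl x h) ha, fun ha => ha ▸ toSpace_mem_cyl x h⟩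

theorem exists_mem_cyl_of_le {m n : ℕ} (h : m ≤ n) {a : G} {p : S.Space} (hp : p ∈ S.cyl m a) :
    ∃ d ∈ S.block m n, p ∈ S.cyl n (a * d) := by
  obtain ⟨x, rfl, rfl⟩ := hp
  obtain ⟨d, hd, h1⟩ := exists_partialProd_eq x le_rfl h
  exact ⟨d, hd, (toSpace_mem_cyl_iff h).2 (by rw [h1, partialProd_self])⟩

theorem cyl_mul_subset_succ {n : ℕ} {a c : G} (ha : a ∈ S.F n) (hc : c ∈ S.C (n + 1)) :
    S.cyl (n + 1) (a * c) ⊆ S.cyl n a := by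
  rintro _ ⟨x, hx, rfl⟩
  -- Undoes the embedding of `X_n` in `X_{n+1}`: the coordinate `a * c` of `x` is split into the two
  -- coordinates `a` and `c`.
  let y : S.Level n := ⟨fun i => if i < n then 1 else if i = n then a else if i = n + 1 then c
    else x.1 i, fun i => by
      rcases lt_trichotomy i n with h | rfl | h
      · simp [digits, h]
      · simpa [digits] using ha
      · rcases eq_or_ne i (n + 1) with rfl | h'
        · simpa [digits] using hc
        · have := x.2 i
          simpa [digits, show ¬ i < n by omega, show i ≠ n by omega, h',
            show ¬ i < n + 1 by omega] using this⟩
  refine ⟨y, by simp [y], toSpace_eq_iff.2 ⟨n + 1, n.le_succ, le_rfl, ?_, fun i hi => ?_⟩⟩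
  · dsimp only
    rw [partialProd_self, hx, partialProd, partialProd_self]
    simp [y]
  · simp [y, show ¬ i < n by omega, show i ≠ n by omega, show i ≠ n + 1 by omega]

theorem cyl_mul_subset {m n : ℕ} (h : m ≤ n) {a d : G} (ha : a ∈ S.F m) (hd : d ∈ S.block m n) :
    S.cyl n (a * d) ⊆ S.cyl m a := by
  induction n, h using Nat.le_induction generalizing d with
  | base => rw [mem_block_self.1 hd, mul_one]
  | succ n hn ih =>
    obtain ⟨e, he, c, hc, rfl⟩ := (mem_block_succ hn).1 hd
    rw [← mul_assoc]
    exact (cyl_mul_subset_succ (mul_block_mem_F hn ha he) hc).trans (ih he)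

/-- The criterion depends on the label `b` only, not on `p`: a cylinder of higher level lies inside
`[a]_m` or misses it. -/
theorem mem_cyl_iff_of_le {m n : ℕ} (h : m ≤ n) {a b : G} (ha : a ∈ S.F m) {p : S.Space}
    (hp : p ∈ S.cyl n b) : p ∈ S.cyl m a ↔ ∃ d ∈ S.block m n, a * d = b := by
  constructor
  · intro hp'
    obtain ⟨d, hd, h1⟩ := exists_mem_cyl_of_le h hp'
    exact ⟨d, hd, cyl_unique h1 hp⟩
  · rintro ⟨d, hd, rfl⟩
    exact cyl_mul_subset h ha hd hp

theorem cyl_disjoint {n : ℕ} {a b : G} (h : a ≠ b) : Disjoint (S.cyl n a) (S.cyl n b) :=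
  Set.disjoint_left.2 fun _ ha hb => h (cyl_unique ha hb)

theorem exists_forall_mem_cyl (p : S.Space) : ∃ N, ∀ n, N ≤ n → ∃ a, p ∈ S.cyl n a := by
  obtain ⟨⟨N, x⟩, rfl⟩ := Quotient.exists_rep p
  exact ⟨N, fun n hn => ⟨_, toSpace_mem_cyl x hn⟩⟩

theorem cyl_nonempty {n : ℕ} {a : G} (ha : a ∈ S.F n) : (S.cyl n a).Nonempty := by
  choose c hc using S.nonempty_C
  let x : S.Level n := ⟨fun i => if i < n then 1 else if i = n then a else c (i - 1), fun i => by
    rcases lt_trichotomy i n with h | rfl | h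
    · simp [digits, h]
    · simpa [digits] using ha
    · obtain ⟨i, rfl⟩ : ∃ j, i = j + 1 := ⟨i - 1, by omega⟩
      simpa [digits, show ¬ i + 1 < n by omega, show i + 1 ≠ n by omega] using hc i⟩
  exact ⟨_, x, by simp [x], rfl⟩

/-- Points which lie in common cylinders of arbitrarily high level coincide. -/
theorem eq_of_forall_exists_cyl {p q : S.Space}
    (h : ∀ N, ∃ n, N ≤ n ∧ ∃ a, p ∈ S.cyl n a ∧ q ∈ S.cyl n a) : p = q := by
  obtain ⟨N, hN⟩ := exists_forall_mem_cyl p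
  obtain ⟨M, hM⟩ := exists_forall_mem_cyl q
  obtain ⟨_, x, -, rfl⟩ := hN (max N M) (le_max_left _ _)
  obtain ⟨_, y, -, rfl⟩ := hM (max N M) (le_max_right _ _)
  congr 1
  refine Subtype.ext (funext fun i => ?_)
  obtain ⟨n, hn, a, hx, hy⟩ := h (max (max N M) i)
  have h1 : max N M ≤ n := (le_max_left _ _).trans hn
  exact level_eq_of_partialProd_eq h1
    (((toSpace_mem_cyl_iff h1).1 hx).trans ((toSpace_mem_cyl_iff h1).1 hy).symm) i
    ((le_max_right _ _).trans hn)

theorem mem_domainOf_iff {g : G} {p : S.Space} :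
    p ∈ S.domainOf g ↔ ∃ n a, p ∈ S.cyl n a ∧ g * a ∈ S.F n :=
  ⟨fun ⟨n, x, h, hx⟩ => ⟨n, x.1 n, ⟨x, rfl, h⟩, hx⟩,
    fun ⟨n, _, ⟨x, hx, h⟩, ha⟩ => ⟨n, x, h, hx ▸ ha⟩⟩

theorem act_mem_cyl {g : G} {p : S.Space} (hp : p ∈ S.domainOf g) {n : ℕ} {a : G}
    (h : p ∈ S.cyl n a) (hga : g * a ∈ S.F n) : act g p hp ∈ S.cyl n (g * a) := by
  obtain ⟨x, rfl, hx⟩ := h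
  rw [act_eq hp hx hga]
  exact ⟨translate g x hga, by simp [translate], rfl⟩

theorem smul_mem_cyl {g : G} {p : S.domain} {n : ℕ} {a : G}
    (h : p.1 ∈ S.cyl n a) (hga : g * a ∈ S.F n) : (g • p).1 ∈ S.cyl n (g * a) :=
  act_mem_cyl (Set.mem_iInter.1 p.2 g) h hga

theorem isClopen_partialProd_mem (n k : ℕ) (A : Set G) :
    IsClopen {x : S.Level n | partialProd x.1 k ∈ A} := by
  let : TopologicalSpace G := ⊥
  have : DiscreteTopology G := ⟨rfl⟩
  have h1 : ∀ i, Continuous fun x : S.Level n => x.1 i := fun i =>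
    (continuous_apply i).comp continuous_subtype_val
  have h2 : Continuous fun x : S.Level n => partialProd x.1 k := by
    induction k with
    | zero => exact h1 0
    | succ k ih => exact ih.mul (h1 (k + 1))
  exact (isClopen_discrete A).preimage h2

instance (n : ℕ) : CompactSpace (S.Level n) := by
  let : TopologicalSpace G := ⊥
  have : DiscreteTopology G := ⟨rfl⟩
  have h : IsCompact {x : ℕ → G | ∀ i, x i ∈ S.digits n i} := by
    have := isCompact_univ_pi fun i => (S.digits n i).finite_toSet.isCompact
    simpa [Set.pi] using this
  exact isCompact_iff_compactSpace.1 h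

/-- Existence of a point with prescribed coordinates along a sequence of levels. -/
theorem exists_forall_cyl {κ : ℕ → ℕ} (hκ : Monotone κ) {N : ℕ} {z : ℕ → G}
    (h0 : z N ∈ S.F (κ N))
    (h1 : ∀ n, N ≤ n → ∃ d ∈ S.block (κ n) (κ (n + 1)), z (n + 1) = z n * d) :
    ∃ p, ∀ n, N ≤ n → p ∈ S.cyl (κ n) (z n) := by
  have hF : ∀ n, N ≤ n → z n ∈ S.F (κ n) := fun n hn => by
    induction n, hn using Nat.le_induction with
    | base => exact h0
    | succ n hn ih =>
      obtain ⟨d, hd, h⟩ := h1 n hn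
      exact h ▸ mul_block_mem_F (hκ n.le_succ) ih hd
  have hsub : ∀ n, N ≤ n → S.cyl (κ (n + 1)) (z (n + 1)) ⊆ S.cyl (κ n) (z n) := fun n hn => by
    obtain ⟨d, hd, h⟩ := h1 n hn
    rw [h]
    exact cyl_mul_subset (hκ n.le_succ) (hF n hn) hd
  have hsub' : ∀ n, N ≤ n → S.cyl (κ n) (z n) ⊆ S.cyl (κ N) (z N) := fun n hn => by
    induction n, hn using Nat.le_induction with
    | base => exact subset_rfl
    | succ n hn ih => exact (hsub n hn).trans ih
  have hle : ∀ j, κ N ≤ κ (N + j) := fun j => hκ (Nat.le_add_right N j)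
  -- The cylinders decrease, so they can be viewed inside the single compact space `X_{κ N}`, as
  -- nested nonempty closed sets.
  let K : ℕ → Set (S.Level (κ N)) := fun j => {x | partialProd x.1 (κ (N + j)) ∈ ({z (N + j)} : Set G)}
  have hK : ∀ j x, x ∈ K j ↔ S.toSpace _ x ∈ S.cyl (κ (N + j)) (z (N + j)) := fun j x =>
    (toSpace_mem_cyl_iff (hle j)).symm
  obtain ⟨x, hx⟩ := IsCompact.nonempty_iInter_of_sequence_nonempty_isCompact_isClosed K
    (fun j x hx => (hK j x).2 (hsub _ (Nat.le_add_right N j) ((hK (j + 1) x).1 hx)))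
    (fun j => by
      obtain ⟨p, hp⟩ := cyl_nonempty (hF (N + j) (Nat.le_add_right N j))
      obtain ⟨x, -, rfl⟩ := hsub' _ (Nat.le_add_right N j) hp
      exact ⟨x, (hK j x).2 hp⟩)
    (isClopen_partialProd_mem _ _ _).1.isCompact
    (fun j => (isClopen_partialProd_mem _ _ _).1)
  refine ⟨S.toSpace _ x, fun n hn => ?_⟩
  obtain ⟨j, rfl⟩ := Nat.exists_eq_add_of_le hn
  exact (hK j x).1 (Set.mem_iInter.1 hx j)

end CFSequence

/-! ### Topology and Borel structure of `X`. -/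

namespace CFSequence

variable {G : Type*} [Group G] {S : CFSequence G}

theorem isOpen_iff {U : Set S.Space} : IsOpen U ↔ ∀ n, IsOpen (S.toSpace n ⁻¹' U) :=
  (isQuotientMap_quot_mk (X := Σ n, S.Level n) (r := S.setoid)).isOpen_preimage.symm.trans
    isOpen_sigma_iff

theorem preimage_cyl {m n k : ℕ} (hm : m ≤ k) (hn : n ≤ k) {a : G} (ha : a ∈ S.F n) :
    S.toSpace m ⁻¹' S.cyl n a = {x | partialProd x.1 k ∈ {b | ∃ d ∈ S.block n k, a * d = b}} := by
  ext x
  exact mem_cyl_iff_of_le hn ha (toSpace_mem_cyl x hm)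

theorem cyl_eq_empty {n : ℕ} {a : G} (ha : a ∉ S.F n) : S.cyl n a = ∅ :=
  Set.eq_empty_of_forall_notMem fun _ hp => ha (mem_F_of_mem_cyl hp)

theorem isOpen_cyl (n : ℕ) (a : G) : IsOpen (S.cyl n a) := by
  by_cases ha : a ∈ S.F n
  · refine isOpen_iff.2 fun m => ?_
    rw [preimage_cyl (le_max_left m n) (le_max_right m n) ha]
    exact (isClopen_partialProd_mem _ _ _).2
  · rw [cyl_eq_empty ha]
    exact isOpen_empty

theorem exists_cyl_subset {U : Set S.Space} (hU : IsOpen U) {p : S.Space} (hp : p ∈ U) :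
    ∃ n a, p ∈ S.cyl n a ∧ S.cyl n a ⊆ U := by
  obtain ⟨⟨n, x⟩, rfl⟩ := Quotient.exists_rep p
  let : TopologicalSpace G := ⊥
  obtain ⟨V, hV, hVU⟩ := isOpen_induced_iff.1 (isOpen_iff.1 hU n)
  have hVU' : ∀ y : S.Level n, y.1 ∈ V ↔ S.toSpace n y ∈ U := fun y => Set.ext_iff.1 hVU y
  have hx : x.1 ∈ V := (hVU' x).2 hp
  obtain ⟨I, u, hu, hI⟩ := isOpen_pi_iff.1 hV x.1 hx
  -- A basic neighbourhood restricts only the coordinates in the finite set `I`; a cylinder of level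
  -- at least `n` and all of `I` fixes them.
  let k := max n (I.sup id)
  have hk : n ≤ k := le_max_left _ _
  refine ⟨k, partialProd x.1 k, toSpace_mem_cyl x hk, fun q hq => ?_⟩
  obtain ⟨d, hd, h1⟩ := exists_partialProd_eq x le_rfl hk
  have hq' := hq
  rw [h1] at hq'
  obtain ⟨y, -, rfl⟩ := cyl_mul_subset hk (partialProd_mem x le_rfl) hd hq'
  have hxy := level_eq_of_partialProd_eq hk ((toSpace_mem_cyl_iff hk).1 hq)
  refine (hVU' y).1 (hI fun i hi => ?_)
  rw [hxy i ((Finset.le_sup (f := id) hi).trans (le_max_right _ _))]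
  exact (hu i hi).2

variable (S) in
/-- The collection of all cylinders. -/
def cylinders : Set (Set S.Space) := Set.range fun q : ℕ × G => S.cyl q.1 q.2

theorem cyl_mem_cylinders (n : ℕ) (a : G) : S.cyl n a ∈ S.cylinders := ⟨(n, a), rfl⟩

theorem isTopologicalBasis_cylinders : TopologicalSpace.IsTopologicalBasis S.cylinders := by
  refine TopologicalSpace.isTopologicalBasis_of_isOpen_of_nhds ?_ fun p U hp hU => ?_
  · rintro _ ⟨q, rfl⟩
    exact isOpen_cyl _ _
  · obtain ⟨n, a, h1, h2⟩ := exists_cyl_subset hU hp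
    exact ⟨_, cyl_mem_cylinders n a, h1, h2⟩

/-- Two cylinders that meet are nested, so their intersection is the one of higher level. -/
theorem isPiSystem_cylinders : IsPiSystem S.cylinders := by
  have key : ∀ (m n : ℕ) (a b : G), m ≤ n → (S.cyl m a ∩ S.cyl n b).Nonempty →
      S.cyl m a ∩ S.cyl n b = S.cyl n b := by
    rintro m n a b h ⟨p, ha, hb⟩
    obtain ⟨d, hd, rfl⟩ := (mem_cyl_iff_of_le h (mem_F_of_mem_cyl ha) hb).1 ha
    exact Set.inter_eq_right.2 (cyl_mul_subset h (mem_F_of_mem_cyl ha) hd)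
  rintro _ ⟨⟨m, a⟩, rfl⟩ _ ⟨⟨n, b⟩, rfl⟩ hne
  rcases le_total m n with h | h
  · rw [key m n a b h hne]
    exact cyl_mem_cylinders n b
  · rw [Set.inter_comm] at hne ⊢
    rw [key n m b a h hne]
    exact cyl_mem_cylinders m a

theorem measurableSet_cyl (n : ℕ) (a : G) : MeasurableSet (S.cyl n a) :=
  (isOpen_cyl n a).measurableSet

theorem measurableSet_domainOf (g : G) : MeasurableSet (S.domainOf g) := by
  refine IsOpen.measurableSet (isOpen_iff_forall_mem_open.2 fun p hp => ?_)
  obtain ⟨n, a, h1, h2⟩ := mem_domainOf_iff.1 hp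
  exact ⟨S.cyl n a, fun q hq => mem_domainOf_iff.2 ⟨n, a, hq, h2⟩, isOpen_cyl n a, h1⟩

theorem prod_card_digits {m j : ℕ} (h : m ≤ j) :
    (∏ i ∈ Finset.range (j + 1), (S.digits m i).card) * S.vol m = (S.F m).card * S.vol j := by
  induction j, h using Nat.le_induction with
  | base =>
    rw [Finset.prod_range_succ, Finset.prod_eq_one fun i hi => ?_, one_mul]
    · simp [digits]
    · simp [digits, Finset.mem_range.1 hi]
  | succ j hj ih =>
    rw [Finset.prod_range_succ, mul_right_comm, ih, vol_succ, mul_assoc]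
    simp [digits, show ¬ j + 1 < m by omega, show j + 1 ≠ m by omega]

theorem cyl_subset_levelSet {m j : ℕ} (h : m ≤ j) {a : G}
    (hne : (S.cyl j a ∩ S.levelSet m).Nonempty) : S.cyl j a ⊆ S.levelSet m := by
  obtain ⟨_, ha, x, rfl⟩ := hne
  rw [toSpace_mem_cyl_iff h] at ha
  subst ha
  obtain ⟨d, hd, h1⟩ := exists_partialProd_eq x le_rfl h
  rw [h1]
  refine (cyl_mul_subset h (partialProd_mem x le_rfl) hd).trans ?_
  rintro _ ⟨y, -, rfl⟩
  exact ⟨y, rfl⟩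

/-- The set is a box with singleton sides up to `j` and sides of probability one beyond, so the
infinite product reduces to a finite one. -/
theorem levelProb_eq_prod {m : ℕ} (j : ℕ) (x₀ : S.Level m) :
    S.levelProb m {x | ∀ i ≤ j, x.1 i = x₀.1 i} =
      ∏ i ∈ Finset.range (j + 1), ((S.digits m i).card : ℝ≥0∞)⁻¹ := by
  classical
  let : MeasurableSpace G := ⊤
  have : MeasurableSingletonClass G := ⟨fun _ => trivial⟩
  have hne : ∀ i, (S.digits m i).Nonempty := fun i => ⟨_, x₀.2 i⟩
  have (i : ℕ) : IsProbabilityMeasure (ProbabilityTheory.uniformOn (S.digits m i : Set G)) :=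
    ProbabilityTheory.isProbabilityMeasure_uniformOn (S.digits m i).finite_toSet (hne i)
  have hmeas : MeasurableSet {x : ℕ → G | ∀ i, x i ∈ S.digits m i} := by
    have heval (i : ℕ) : Measurable fun x : ℕ → G => x i := measurable_pi_apply i
    have hi (i : ℕ) : MeasurableSet {x : ℕ → G | x i ∈ S.digits m i} :=
      heval i (t := (S.digits m i : Set G)) trivial
    simpa only [Set.ofPred_forall] using MeasurableSet.iInter hi
  let t : ℕ → Finset G := fun i => if i ≤ j then {x₀.1 i} else S.digits m i
  let A : Set {x : ℕ → G // ∀ i, x i ∈ S.digits m i} := {x | ∀ i ≤ j, x.1 i = x₀.1 i}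
  have himage : Subtype.val '' A = Set.univ.pi fun i => (t i : Set G) := by
    ext x
    simp only [Set.mem_image, Set.mem_ofPred_eq, Subtype.exists, exists_and_right, exists_eq_right,
      Set.mem_univ_pi, t, A]
    constructor
    · rintro ⟨h1, h2⟩ i
      split_ifs with hi
      · simpa using h2 i hi
      · exact h1 i
    · refine fun h1 => ⟨fun i => ?_, fun i hi => by simpa [hi] using h1 i⟩
      have := h1 i
      split_ifs at this with hi
      · rw [Finset.coe_singleton, Set.mem_singleton_iff] at this
        rw [this]
        exact x₀.2 i
      · exact this
  have h1 := (MeasurableEmbedding.subtype_coe hmeas).comap_apply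
    (Measure.infinitePi fun i => ProbabilityTheory.uniformOn (S.digits m i : Set G)) A
  refine (h1.trans (congrArg _ himage)).trans
    ((Measure.infinitePi_pi_univ _ fun i => (t i).measurableSet).trans ?_)
  rw [tprod_eq_prod (s := Finset.range (j + 1))]
  · refine Finset.prod_congr rfl fun i hi => ?_
    have hi' : i ≤ j := by simpa [Nat.lt_succ_iff] using hi
    rw [ProbabilityTheory.uniformOn_apply_finset]
    simp [t, hi', Finset.inter_singleton_of_mem (x₀.2 i)]
  · intro i hi
    have hi' : ¬ i ≤ j := by simpa [Nat.lt_succ_iff] using hi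
    simp only [t, hi', if_false]
    exact ProbabilityTheory.uniformOn_self (S.digits m i).finite_toSet (hne i)

/-! ### The `(C,F)`-measure and its values on cylinders. -/

section Countable

variable [Countable G]

theorem countable_cylinders : S.cylinders.Countable := Set.countable_range _

instance : SecondCountableTopology S.Space :=
  isTopologicalBasis_cylinders.secondCountableTopology countable_cylinders

variable (S) in
theorem borel_eq_generateFrom_cylinders :
    borel S.Space = MeasurableSpace.generateFrom S.cylinders :=
  isTopologicalBasis_cylinders.borel_eq_generateFrom

variable (S) in
theorem measurableSet_domain : MeasurableSet S.domain :=
  MeasurableSet.iInter measurableSet_domainOf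

theorem measurableSet_partialProd_mem (n k : ℕ) (A : Set G) :
    MeasurableSet {x : S.Level n | partialProd x.1 k ∈ A} := by
  let : MeasurableSpace G := ⊤
  have h1 : ∀ i, Measurable fun x : S.Level n => x.1 i := fun i =>
    (measurable_pi_apply i).comp measurable_subtype_coe
  have h2 : Measurable fun x : S.Level n => partialProd x.1 k := by
    induction k with
    | zero => exact h1 0
    | succ k ih => exact ih.mul (h1 (k + 1))
  exact h2 trivial

theorem measurable_toSpace (n : ℕ) : Measurable (S.toSpace n) := by
  change @Measurable _ _ _ (borel S.Space) _
  rw [borel_eq_generateFrom_cylinders]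
  refine measurable_generateFrom ?_
  rintro _ ⟨⟨m, a⟩, rfl⟩
  by_cases ha : a ∈ S.F m
  · rw [preimage_cyl (le_max_left n m) (le_max_right n m) ha]
    exact measurableSet_partialProd_mem _ _ _
  · simp only [cyl_eq_empty ha, Set.preimage_empty, MeasurableSet.empty]

theorem levelMeasure_cyl {m j : ℕ} (h : m ≤ j) (x₀ : S.Level m) :
    S.levelMeasure m (S.cyl j (partialProd x₀.1 j)) = (S.vol j : ℝ≥0∞)⁻¹ := by
  have hpre : S.toSpace m ⁻¹' S.cyl j (partialProd x₀.1 j) = {x | ∀ i ≤ j, x.1 i = x₀.1 i} := by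
    ext x
    rw [Set.mem_preimage, toSpace_mem_cyl_iff h]
    exact ⟨fun hx => level_eq_of_partialProd_eq h hx, fun hx => partialProd_congr hx⟩
  change (((S.F m).card : ℝ≥0∞) / (S.vol m : ℕ)) *
    (S.levelProb m).map (S.toSpace m) (S.cyl j (partialProd x₀.1 j)) = _
  rw [Measure.map_apply (measurable_toSpace m) (measurableSet_cyl _ _), hpre,
    levelProb_eq_prod j x₀]
  have hP := prod_card_digits (S := S) h
  have hF : (S.F m).card ≠ 0 := (Finset.card_pos.2 (S.nonempty_F m)).ne'
  have hd : ∀ i, (S.digits m i).card ≠ 0 := fun i => Finset.card_ne_zero_of_mem (x₀.2 i)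
  rw [← ENNReal.prod_inv_distrib fun i _ j _ _ => Or.inl (by simpa using hd i)]
  have hP' : (∏ i ∈ Finset.range (j + 1), ((S.digits m i).card : ℝ≥0∞)) * S.vol m =
      (S.F m).card * S.vol j := by exact_mod_cast hP
  rw [ENNReal.div_eq_inv_mul, mul_comm ((S.vol m : ℝ≥0∞)⁻¹), mul_assoc,
    ← ENNReal.mul_inv (Or.inl (by simpa using (S.vol_pos m).ne')) (Or.inl (by simp)),
    mul_comm (S.vol m : ℝ≥0∞), hP', ENNReal.mul_inv (Or.inl (by simpa using hF)) (Or.inl (by simp)),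
    ← mul_assoc, ENNReal.mul_inv_cancel (by simpa using hF) (by simp), one_mul]

/-- Let `m₀` be the first level containing the cylinder. Earlier levels miss it altogether, and for
later levels it lies in the part removed by the restriction, so only the summand `m₀` counts. -/
theorem measure_cyl {j : ℕ} {a : G} (ha : a ∈ S.F j) :
    S.measure (S.cyl j a) = (S.vol j : ℝ≥0∞)⁻¹ := by
  classical
  have hex : ∃ m, S.cyl j a ⊆ S.levelSet m := by
    refine ⟨j, ?_⟩
    rintro _ ⟨y, -, rfl⟩
    exact ⟨y, rfl⟩
  let m₀ := Nat.find hex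
  have hm₀ : S.cyl j a ⊆ S.levelSet m₀ := Nat.find_spec hex
  have hm₀j : m₀ ≤ j := Nat.find_min' hex (by
    rintro _ ⟨y, -, rfl⟩
    exact ⟨y, rfl⟩)
  have hlt : ∀ m < m₀, S.cyl j a ∩ S.levelSet m = ∅ := fun m hm => by
    by_contra hne
    exact Nat.find_min hex hm
      (cyl_subset_levelSet (hm.le.trans hm₀j) (Set.nonempty_iff_ne_empty.2 hne))
  rw [measure, Measure.sum_apply _ (measurableSet_cyl _ _), tsum_eq_single m₀]
  · rw [Measure.restrict_apply (measurableSet_cyl _ _), Set.inter_eq_left.2]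
    · obtain ⟨p, hp⟩ := cyl_nonempty ha
      obtain ⟨x, rfl⟩ := hm₀ hp
      rw [toSpace_mem_cyl_iff hm₀j] at hp
      rw [← hp, levelMeasure_cyl hm₀j]
    · intro p hp hp'
      simp only [Set.mem_iUnion] at hp'
      obtain ⟨m, hm, hp'⟩ := hp'
      exact (hlt m hm).subset ⟨hp, hp'⟩
  · intro n hn
    rw [Measure.restrict_apply (measurableSet_cyl _ _)]
    rcases hn.lt_or_gt with h | h
    · refine measure_mono_null Set.inter_subset_left ?_
      rw [levelMeasure, Measure.smul_apply,
        Measure.map_apply (measurable_toSpace n) (measurableSet_cyl _ _)]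
      have : S.toSpace n ⁻¹' S.cyl j a = ∅ :=
        Set.eq_empty_of_forall_notMem fun x hx => (hlt n h).subset ⟨hx, x, rfl⟩
      simp [this]
    · convert measure_empty (μ := S.levelMeasure n)
      refine Set.eq_empty_of_forall_notMem fun p hp => hp.2 ?_
      simp only [Set.mem_iUnion]
      exact ⟨m₀, h, hm₀ hp.1⟩

theorem measure_cyl_ne_top (j : ℕ) (a : G) : S.measure (S.cyl j a) ≠ ∞ := by
  by_cases ha : a ∈ S.F j
  · rw [measure_cyl ha]
    simpa using (S.vol_pos j).ne'
  · simp [cyl_eq_empty ha]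

/-- A measure which agrees with the `(C,F)`-measure up to a constant on cylinders agrees with it
up to this constant. -/
theorem eq_smul_measure_of_cyl {ν : Measure S.Space} {c : ℝ≥0∞} (hc : c ≠ ∞)
    (h : ∀ n, ∀ a ∈ S.F n, ν (S.cyl n a) = c * (S.vol n : ℝ≥0∞)⁻¹) : ν = c • S.measure := by
  have heq : ∀ s ∈ S.cylinders, ν s = (c • S.measure) s := by
    rintro _ ⟨⟨n, a⟩, rfl⟩
    by_cases ha : a ∈ S.F n
    · simp [h n a ha, measure_cyl ha]
    · simp [cyl_eq_empty ha]
  refine Measure.ext_of_generateFrom_of_cover_subset (borel_eq_generateFrom_cylinders S)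
    isPiSystem_cylinders subset_rfl countable_cylinders ?_ ?_ heq
  · refine Set.eq_univ_of_forall fun p => ?_
    obtain ⟨N, hN⟩ := exists_forall_mem_cyl p
    obtain ⟨a, ha⟩ := hN N le_rfl
    exact ⟨_, cyl_mem_cylinders N a, ha⟩
  · intro s hs
    rw [heq s hs]
    obtain ⟨⟨n, a⟩, rfl⟩ := hs
    exact ENNReal.mul_ne_top hc (measure_cyl_ne_top n a)

end Countable

end CFSequence

/-! ### Thinnings and the embeddings they induce. -/

namespace CFSequence

variable {G : Type*} [Group G] {S T : CFSequence G} {κ : ℕ → ℕ}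

/-- `T` is obtained from `S` by passing to the levels `κ 0 < κ 1 < ⋯` and replacing the products
`C (κ n + 1) * ⋯ * C (κ (n + 1))` by subsets of them. -/
structure IsThinning (S T : CFSequence G) (κ : ℕ → ℕ) : Prop where
  strictMono : StrictMono κ
  F_eq : ∀ n, T.F n = S.F (κ n)
  C_subset : ∀ n, T.C (n + 1) ⊆ S.block (κ n) (κ (n + 1))

theorem exists_cyl_of_mem_domainOf {g : G} {p : S.Space} (hp : p ∈ S.domainOf g) (N : ℕ) :
    ∃ n, N ≤ n ∧ ∃ a, p ∈ S.cyl n a ∧ g * a ∈ S.F n := by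
  obtain ⟨n, a, h1, h2⟩ := mem_domainOf_iff.1 hp
  obtain ⟨d, hd, h3⟩ := exists_mem_cyl_of_le (le_max_right N n) h1
  refine ⟨max N n, le_max_left N n, a * d, h3, ?_⟩
  rw [← mul_assoc]
  exact mul_block_mem_F (le_max_right N n) h2 hd

theorem measure_biUnion_cyl [Countable G] {n : ℕ} {a : G} {A : Finset G}
    (h : ∀ d ∈ A, a * d ∈ S.F n) :
    S.measure (⋃ d ∈ A, S.cyl n (a * d)) = A.card * (S.vol n : ℝ≥0∞)⁻¹ := by
  rw [measure_biUnion_finset (fun d _ e _ hde => cyl_disjoint fun h => hde (mul_left_cancel h))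
    fun d _ => measurableSet_cyl _ _, Finset.sum_congr rfl fun d hd => measure_cyl (h d hd)]
  simp

namespace IsThinning

section Lift

variable (H : IsThinning S T κ)

include H

theorem mono {m n : ℕ} (h : m ≤ n) : κ m ≤ κ n := H.strictMono.monotone h

theorem block_subset {m n : ℕ} (h : m ≤ n) : T.block m n ⊆ S.block (κ m) (κ n) := by
  induction n, h using Nat.le_induction with
  | base => rw [block_self, block_self]
  | succ n hn ih =>
    intro d hd
    obtain ⟨e, he, c, hc, rfl⟩ := (mem_block_succ hn).1 hd
    exact mul_mem_block (H.mono hn) (H.mono n.le_succ) (ih he) (H.C_subset n hc)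

/-- Successive labels of `p` differ by factors from `T.C`, hence from the corresponding `S.block`,
so compactness gives a point of the space of `S` with these labels. -/
theorem exists_lift (p : T.Space) : ∃ q : S.Space, ∀ n a, p ∈ T.cyl n a → q ∈ S.cyl (κ n) a := by
  obtain ⟨N, hN⟩ := exists_forall_mem_cyl p
  choose! z hz using hN
  obtain ⟨q, hq⟩ := exists_forall_cyl (S := S) (z := z) H.strictMono.monotone
    (H.F_eq N ▸ mem_F_of_mem_cyl (hz N le_rfl)) fun n hn => by
      obtain ⟨d, hd, h1⟩ := exists_mem_cyl_of_le n.le_succ (hz n hn)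
      exact ⟨d, H.block_subset n.le_succ hd, cyl_unique (hz (n + 1) (by omega)) h1⟩
  refine ⟨q, fun n a h => ?_⟩
  rcases le_or_gt N n with hn | hn
  · rw [cyl_unique h (hz n hn)]
    exact hq n hn
  · obtain ⟨d, hd, h1⟩ := exists_mem_cyl_of_le hn.le h
    refine cyl_mul_subset (H.mono hn.le) (H.F_eq n ▸ mem_F_of_mem_cyl h)
      (H.block_subset hn.le hd) ?_
    rw [← cyl_unique (hz N le_rfl) h1]
    exact hq N le_rfl

/-- The embedding of `(C,F)`-spaces associated with a thinning. -/
noncomputable def lift (p : T.Space) : S.Space := (H.exists_lift p).choose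

theorem lift_mem_cyl {p : T.Space} {n : ℕ} {a : G} (h : p ∈ T.cyl n a) :
    H.lift p ∈ S.cyl (κ n) a :=
  (H.exists_lift p).choose_spec n a h

/-- Characterizes the point chosen in `lift`: agreement at arbitrarily high levels suffices. -/
theorem eq_lift {p : T.Space} {q : S.Space}
    (h : ∀ N, ∃ n, N ≤ n ∧ ∃ a, p ∈ T.cyl n a ∧ q ∈ S.cyl (κ n) a) : H.lift p = q :=
  eq_of_forall_exists_cyl fun N => by
    obtain ⟨n, hn, a, h1, h2⟩ := h N
    exact ⟨κ n, hn.trans (H.strictMono.le_apply), a, H.lift_mem_cyl h1, h2⟩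

theorem lift_injective : Function.Injective H.lift := fun p q h =>
  eq_of_forall_exists_cyl fun N => by
    obtain ⟨M, hM⟩ := exists_forall_mem_cyl p
    obtain ⟨M', hM'⟩ := exists_forall_mem_cyl q
    obtain ⟨a, ha⟩ := hM (max N (max M M')) (by omega)
    obtain ⟨b, hb⟩ := hM' (max N (max M M')) (by omega)
    have := H.lift_mem_cyl hb
    rw [← h] at this
    refine ⟨_, le_max_left _ _, a, ha, ?_⟩
    rwa [cyl_unique (H.lift_mem_cyl ha) this]

theorem continuous_lift : Continuous H.lift := by
  refine isTopologicalBasis_cylinders.continuous_iff.2 ?_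
  rintro _ ⟨⟨m, a⟩, rfl⟩
  refine isOpen_iff_forall_mem_open.2 fun p hp => ?_
  obtain ⟨N, hN⟩ := exists_forall_mem_cyl p
  obtain ⟨b, hb⟩ := hN (max N m) (le_max_left _ _)
  have hm : m ≤ κ (max N m) := (le_max_right N m).trans H.strictMono.le_apply
  have ha := mem_F_of_mem_cyl hp
  refine ⟨_, fun q hq => ?_, isOpen_cyl _ b, hb⟩
  exact (mem_cyl_iff_of_le hm ha (H.lift_mem_cyl hq)).2
    ((mem_cyl_iff_of_le hm ha (H.lift_mem_cyl hb)).1 hp)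

theorem mul_mem_F_of_mem_block {n j : ℕ} (h : n ≤ j) {a d : G} (ha : a ∈ T.F n)
    (hd : d ∈ T.block n j) : a * d ∈ S.F (κ j) :=
  H.F_eq j ▸ mul_block_mem_F h ha hd

theorem antitone_biUnion_cyl {n : ℕ} {a : G} (ha : a ∈ T.F n) :
    Antitone fun i => ⋃ d ∈ T.block n (n + i), S.cyl (κ (n + i)) (a * d) := by
  refine antitone_nat_of_succ_le fun i p hp => ?_
  simp only [Set.mem_iUnion, exists_prop] at hp ⊢
  obtain ⟨d, hd, hp⟩ := hp
  obtain ⟨e, he, c, hc, rfl⟩ := (mem_block_succ (Nat.le_add_right n i)).1 hd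
  rw [← mul_assoc] at hp
  exact ⟨e, he, cyl_mul_subset (H.mono (n + i).le_succ)
    (H.mul_mem_F_of_mem_block (Nat.le_add_right n i) ha he) (H.C_subset _ hc) hp⟩

/-- A point of the intersection has a label `a * d i` at each level, with `d i` in a `T.block`.
Uniqueness of labels makes these coherent, so they come from a point of the space of `T`. -/
theorem image_lift_cyl {n : ℕ} {a : G} (ha : a ∈ T.F n) :
    H.lift '' T.cyl n a = ⋂ i, ⋃ d ∈ T.block n (n + i), S.cyl (κ (n + i)) (a * d) := by
  ext q
  simp only [Set.mem_iInter, Set.mem_iUnion, exists_prop]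
  constructor
  · rintro ⟨p, hp, rfl⟩ i
    obtain ⟨d, hd, h1⟩ := exists_mem_cyl_of_le (Nat.le_add_right n i) hp
    exact ⟨d, hd, H.lift_mem_cyl h1⟩
  · intro h
    choose d hd hq using h
    have h0 : d 0 = 1 := mem_block_self.1 (hd 0)
    obtain ⟨p, hp⟩ := exists_forall_cyl (S := T) (κ := fun i => n + i) (N := 0)
      (z := fun i => a * d i) (fun _ _ h => Nat.add_le_add_left h n)
      (by simpa [h0] using ha) fun i _ => by
        obtain ⟨e, he, c, hc, h1⟩ := (mem_block_succ (Nat.le_add_right n i)).1 (hd (i + 1))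
        refine ⟨c, mem_block_one hc, ?_⟩
        have h2 := hq (i + 1)
        rw [← h1, ← mul_assoc] at h2
        have h3 := cyl_mul_subset (H.mono (n + i).le_succ)
          (H.mul_mem_F_of_mem_block (Nat.le_add_right n i) ha he) (H.C_subset _ hc) h2
        rw [cyl_unique (hq i) h3, ← h1, mul_assoc]
    refine ⟨p, by simpa [h0] using hp 0 le_rfl, H.eq_lift fun N => ⟨n + N, by omega, _,
      hp N N.zero_le, hq N⟩⟩

theorem lift_mem_domain {p : T.Space} (hp : p ∈ T.domain) : H.lift p ∈ S.domain := by
  refine Set.mem_iInter.2 fun g => ?_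
  obtain ⟨n, a, h1, h2⟩ := mem_domainOf_iff.1 (Set.mem_iInter.1 hp g)
  exact mem_domainOf_iff.2 ⟨κ n, a, H.lift_mem_cyl h1, H.F_eq n ▸ h2⟩

/-- The embedding `lift`, restricted to the sets on which the `(C,F)`-actions are defined. -/
noncomputable def domainLift (p : T.domain) : S.domain := ⟨H.lift p.1, H.lift_mem_domain p.2⟩

theorem domainLift_smul (g : G) (p : T.domain) : H.domainLift (g • p) = g • H.domainLift p := by
  refine Subtype.ext (H.eq_lift fun N => ?_)
  obtain ⟨n, hn, a, h1, h2⟩ := exists_cyl_of_mem_domainOf (Set.mem_iInter.1 p.2 g) N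
  exact ⟨n, hn, g * a, smul_mem_cyl h1 h2,
    smul_mem_cyl (p := H.domainLift p) (H.lift_mem_cyl h1) (H.F_eq n ▸ h2)⟩

theorem measurableSet_image_lift_cyl (n : ℕ) (a : G) : MeasurableSet (H.lift '' T.cyl n a) := by
  by_cases ha : a ∈ T.F n
  · rw [H.image_lift_cyl ha]
    exact MeasurableSet.iInter fun i =>
      Finset.measurableSet_biUnion _ fun d _ => measurableSet_cyl _ _
  · simp [cyl_eq_empty ha]

variable [Countable G]

/-- Images need to be tested only on cylinders, which generate the Borel sets. -/
theorem measurableEmbedding_lift : MeasurableEmbedding H.lift := by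
  refine MeasurableEmbedding.iff_comap_eq.2 ⟨H.lift_injective, le_antisymm
    H.continuous_lift.measurable.comap_le ?_, ?_⟩
  · change borel T.Space ≤ _
    rw [borel_eq_generateFrom_cylinders]
    refine MeasurableSpace.generateFrom_le ?_
    rintro _ ⟨⟨n, a⟩, rfl⟩
    exact ⟨_, H.measurableSet_image_lift_cyl n a, H.lift_injective.preimage_image _⟩
  · have : Set.range H.lift = ⋃ n, ⋃ a, H.lift '' T.cyl n a := by
      simp only [← Set.image_iUnion]
      rw [← Set.image_univ]
      congr 1
      refine (Set.eq_univ_of_forall fun p => ?_).symm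
      obtain ⟨N, hN⟩ := exists_forall_mem_cyl p
      obtain ⟨a, ha⟩ := hN N le_rfl
      exact Set.mem_iUnion₂.2 ⟨N, a, ha⟩
    rw [this]
    exact MeasurableSet.iUnion fun n => MeasurableSet.iUnion (H.measurableSet_image_lift_cyl n)

variable {c : ℝ≥0∞} (hc : Tendsto (fun n => (T.vol n : ℝ≥0∞) / S.vol (κ n)) atTop (𝓝 c))

include hc

/-- Continuity from above: the `i`-th set of the intersection consists of `T.vol (n+i) / T.vol n`
cylinders, each of mass `1 / S.vol (κ (n+i))`. -/
theorem measure_image_lift_cyl {n : ℕ} {a : G} (ha : a ∈ T.F n) :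
    S.measure (H.lift '' T.cyl n a) = c * (T.vol n : ℝ≥0∞)⁻¹ := by
  have hT : ∀ n, (T.vol n : ℝ≥0∞) ≠ 0 := fun n => by simpa using (T.vol_pos n).ne'
  have hm : ∀ i, S.measure (⋃ d ∈ T.block n (n + i), S.cyl (κ (n + i)) (a * d)) =
      (T.vol n : ℝ≥0∞)⁻¹ * ((T.vol (n + i) : ℝ≥0∞) / S.vol (κ (n + i))) := fun i => by
    rw [measure_biUnion_cyl fun d hd => H.mul_mem_F_of_mem_block (Nat.le_add_right n i) ha hd,
      ← vol_mul_card_block (Nat.le_add_right n i), Nat.cast_mul, div_eq_mul_inv, mul_assoc,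
      ENNReal.inv_mul_cancel_left (by simp [hT]) (by simp)]
  have h1 := tendsto_measure_iInter_atTop (μ := S.measure)
    (fun i => (Finset.measurableSet_biUnion _ fun d _ => measurableSet_cyl _ _).nullMeasurableSet)
    (H.antitone_biUnion_cyl ha) ⟨0, by
      rw [hm]
      exact ENNReal.mul_ne_top (by simp [hT])
        (ENNReal.div_ne_top (by simp) (by simpa using (S.vol_pos _).ne'))⟩
  rw [H.image_lift_cyl ha, mul_comm]
  refine tendsto_nhds_unique h1 ?_
  simp only [Function.comp_def, hm]
  refine ENNReal.Tendsto.const_mul ?_ (Or.inr (by simp [hT]))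
  simpa only [add_comm n] using (tendsto_add_atTop_iff_nat n).2 hc

theorem comap_lift_measure (hc' : c ≠ ∞) : S.measure.comap H.lift = c • T.measure :=
  eq_smul_measure_of_cyl hc' fun n a ha => by
    rw [H.measurableEmbedding_lift.comap_apply, H.measure_image_lift_cyl hc ha]

theorem measure_image_lift (hc' : c ≠ ∞) (s : Set T.Space) :
    S.measure (H.lift '' s) = c * T.measure s := by
  rw [← H.measurableEmbedding_lift.comap_apply, H.comap_lift_measure hc hc']
  rfl

theorem measure_compl_range_lift (hc' : c ≠ ∞) (hc0 : c ≠ 0) :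
    S.measure (Set.range H.lift)ᶜ = 0 := by
  have hT : ∀ n, (T.vol n : ℝ≥0∞) ≠ 0 := fun n => by simpa using (T.vol_pos n).ne'
  have hS : ∀ n, (S.vol n : ℝ≥0∞) ≠ 0 := fun n => by simpa using (S.vol_pos n).ne'
  have key : ∀ n, ∀ a ∈ S.F (κ n), S.measure (S.cyl (κ n) a \ Set.range H.lift) = 0 := by
    intro n a ha
    have hle : S.measure (S.cyl (κ n) a) ≤ S.measure (S.cyl (κ n) a ∩ Set.range H.lift) := by
      -- As `T.F j` is all of `S.F (κ j)`, every `a * d` with `d` in the full `S.block`, not only in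
      -- `T.block`, labels a cylinder of `T`. Counting these bounds the mass of the range below, and
      -- the bound tends to the full mass of the cylinder.
      have h1 : ∀ j, n ≤ j → (S.vol (κ n) : ℝ≥0∞)⁻¹ * (c * ((T.vol j : ℝ≥0∞) / S.vol (κ j))⁻¹) ≤
          S.measure (S.cyl (κ n) a ∩ Set.range H.lift) := fun j hj => by
        have hsub : ⋃ d ∈ S.block (κ n) (κ j), T.cyl j (a * d) ⊆ H.lift ⁻¹' S.cyl (κ n) a := by
          refine Set.iUnion₂_subset fun d hd p hp => ?_
          exact cyl_mul_subset (H.mono hj) ha hd (H.lift_mem_cyl hp)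
        rw [← Set.image_preimage_eq_inter_range, H.measure_image_lift hc hc']
        refine le_trans (le_of_eq ?_) (mul_le_mul_right (measure_mono hsub) c)
        rw [measure_biUnion_cyl fun d hd => (H.F_eq j).symm ▸ mul_block_mem_F (H.mono hj) ha hd,
          ← vol_mul_card_block (H.mono hj), ENNReal.inv_div (by simp) (by simp [hT]), Nat.cast_mul,
          mul_left_comm, div_eq_mul_inv, mul_assoc,
          ENNReal.inv_mul_cancel_left (by simp [hS]) (by simp)]
      have h2 : Tendsto (fun j => (S.vol (κ n) : ℝ≥0∞)⁻¹ *
          (c * ((T.vol j : ℝ≥0∞) / S.vol (κ j))⁻¹)) atTop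
          (𝓝 ((S.vol (κ n) : ℝ≥0∞)⁻¹ * (c * c⁻¹))) :=
        ENNReal.Tendsto.const_mul (ENNReal.Tendsto.const_mul
          (tendsto_inv_iff.2 hc) (Or.inr hc')) (Or.inr (by simp [hS]))
      rw [ENNReal.mul_inv_cancel hc0 hc', mul_one] at h2
      rw [measure_cyl ha]
      exact le_of_tendsto h2 (eventually_atTop.2 ⟨n, h1⟩)
    have hadd := measure_inter_add_sdiff (μ := S.measure) (S.cyl (κ n) a)
      H.measurableEmbedding_lift.measurableSet_range
    have hfin := measure_cyl_ne_top (S := S) (κ n) a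
    have h3 : S.measure (S.cyl (κ n) a ∩ Set.range H.lift) ≠ ∞ :=
      measure_ne_top_of_subset Set.inter_subset_left hfin
    refine le_antisymm ?_ bot_le
    refine (ENNReal.add_le_add_iff_left h3).1 ?_
    rw [hadd]
    simpa using hle
  have hcover : (Set.range H.lift)ᶜ ⊆ ⋃ n, ⋃ a ∈ S.F (κ n), (S.cyl (κ n) a \ Set.range H.lift) := by
    intro p hp
    obtain ⟨N, hN⟩ := exists_forall_mem_cyl p
    obtain ⟨a, ha⟩ := hN (κ N) H.strictMono.le_apply
    simp only [Set.mem_iUnion]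
    exact ⟨N, a, mem_F_of_mem_cyl ha, ha, hp⟩
  refine measure_mono_null hcover (measure_iUnion_null fun n => ?_)
  exact (measure_biUnion_null_iff (S.F (κ n)).countable_toSet).2 fun a ha => key n a ha

end Lift

end IsThinning

end CFSequence

/-! ### Isomorphism invariance of rank one. -/

section Transfer

variable {G : Type*} [Group G] {X Y : Type*} [MeasurableSpace X] [MeasurableSpace Y]
  [MulAction G X] [MulAction G Y] {μ : Measure X} {ν : Measure Y}

/-- Being of rank one is invariant under isomorphism. -/
theorem IsRankOne.of_measureIsomorphic {e : Multiplicative ℤ ≃* G} (h : IsRankOne e μ)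
    (hiso : MeasureIsomorphic G μ ν) : IsRankOne e ν := by
  obtain ⟨A, B, hA, φ, c, hAm, hBm, hA0, hB0, hφ, hc0, hc, hμ⟩ := hiso
  obtain ⟨D, N, hD, hdisj, happrox⟩ := h
  -- Transport of sets along `φ`, ignoring what lies outside `A`; it commutes with `G` and satisfies
  -- `c * ν (Φ U) = μ U`.
  let Φ : Set X → Set Y := fun U => Subtype.val '' (φ '' (Subtype.val ⁻¹' U))
  have mem_Φ : ∀ U y, y ∈ Φ U ↔ ∃ x : A, x.1 ∈ U ∧ (φ x : Y) = y := fun U y => by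
    simp only [Φ, Set.mem_image, Set.mem_preimage, exists_exists_and_eq_and]
  have Φ_measurable : ∀ U, MeasurableSet U → MeasurableSet (Φ U) := fun U hU =>
    hBm.subtype_image ((MeasurableEquiv.measurableSet_image φ).2 (measurable_subtype_coe hU))
  have Φ_measure : ∀ U, c * ν (Φ U) = μ U := fun U => by
    have h1 := congrArg (fun m : Measure B => m (φ '' (Subtype.val ⁻¹' U))) hμ
    simp only [MeasurableEquiv.map_apply, Measure.smul_apply, smul_eq_mul,
      (MeasurableEmbedding.subtype_coe hAm).comap_apply,
      (MeasurableEmbedding.subtype_coe hBm).comap_apply] at h1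
    rw [Set.preimage_image_eq _ φ.injective, Subtype.image_preimage_coe,
      Set.inter_comm, measure_inter_conull hA0] at h1
    exact h1.symm
  have Φ_smul : ∀ (g : G) U, Φ (g • U) = g • Φ U := fun g U => by
    ext y
    simp only [mem_Φ, Set.mem_smul_set]
    constructor
    · rintro ⟨⟨_, hx⟩, ⟨u, hu, rfl⟩, rfl⟩
      have hu' : u ∈ A := by simpa using hA g⁻¹ _ hx
      exact ⟨_, ⟨⟨u, hu'⟩, hu, rfl⟩, (hφ g ⟨u, hu'⟩).symm⟩
    · rintro ⟨_, ⟨x, hx, rfl⟩, rfl⟩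
      exact ⟨⟨g • x.1, hA g x.1 x.2⟩, ⟨_, hx, rfl⟩, hφ g x⟩
  have Φ_inj : ∀ U (x : A), (φ x : Y) ∈ Φ U ↔ x.1 ∈ U := fun U x => by
    rw [mem_Φ]
    refine ⟨?_, fun hx => ⟨x, hx, rfl⟩⟩
    rintro ⟨x', hx', h1⟩
    rwa [← φ.injective (Subtype.ext h1)]
  refine ⟨fun n => Φ (D n), N, fun n => ⟨Φ_measurable _ (hD n).1, ?_⟩, fun n i hi j hj hij => ?_,
    fun E hE hE' => ?_⟩
  · have h1 := (hD n).2
    rw [← Φ_measure] at h1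
    by_contra h2
    rw [not_lt, top_le_iff] at h2
    rw [h2, ENNReal.mul_top hc0] at h1
    exact lt_irrefl _ h1
  · rw [← Φ_smul, ← Φ_smul, Set.disjoint_left]
    intro y hy hy'
    obtain ⟨x, hx, rfl⟩ := (mem_Φ _ _).1 hy
    exact Set.disjoint_left.1 (hdisj n i hi j hj hij) hx ((Φ_inj _ _).1 hy')
  · let U : Set X := Subtype.val '' (φ ⁻¹' (Subtype.val ⁻¹' E))
    have hU : ∀ x : A, x.1 ∈ U ↔ (φ x : Y) ∈ E := fun x => by simp [U]
    have hUm : MeasurableSet U :=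
      hAm.subtype_image (φ.measurable (measurable_subtype_coe hE))
    have hU' : μ U < ∞ := by
      rw [← Φ_measure]
      refine ENNReal.mul_lt_top hc.lt_top (lt_of_le_of_lt (measure_mono fun y hy => ?_) hE')
      obtain ⟨x, hx, rfl⟩ := (mem_Φ _ _).1 hy
      exact (hU x).1 hx
    have key : ∀ n, c * (⨅ J ∈ (Finset.range (N n)).powerset,
        ν (E ∆ ⋃ j ∈ J, e (Multiplicative.ofAdd (j : ℤ)) • Φ (D n))) ≤
        ⨅ J ∈ (Finset.range (N n)).powerset,
          μ (U ∆ ⋃ j ∈ J, e (Multiplicative.ofAdd (j : ℤ)) • D n) := by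
      -- The same `J` serves on both sides: the two symmetric differences correspond under `φ` up to
      -- the null set `Bᶜ`.
      refine fun n => le_iInf₂ fun J hJ => (mul_le_mul_right (iInf₂_le J hJ) c).trans ?_
      rw [← Φ_measure]
      refine mul_le_mul_right ?_ c
      rw [← measure_inter_conull hB0]
      refine measure_mono ?_
      rintro y ⟨hy, hyB⟩
      obtain ⟨x, hx⟩ := φ.surjective ⟨y, hyB⟩
      obtain rfl : (φ x : Y) = y := congrArg Subtype.val hx
      rw [Φ_inj]
      simpa only [Set.mem_symmDiff, hU, Set.mem_iUnion, ← Φ_smul, Φ_inj] using hy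
    have h1 := tendsto_of_tendsto_of_tendsto_of_le_of_le tendsto_const_nhds
      (happrox U hUm hU') (fun _ => zero_le) key
    have h2 := ENNReal.Tendsto.const_mul (a := c⁻¹) h1 (Or.inr (by simp [hc0]))
    simpa only [ENNReal.inv_mul_cancel_left hc0 hc, mul_zero] using h2

end Transfer

/-! ### The isomorphism given by a thinning. -/

namespace CFSequence

variable {G : Type*} [Group G] {S T : CFSequence G} {κ : ℕ → ℕ}

theorem domainMeasure_apply [Countable G] (s : Set S.domain) :
    S.domainMeasure s = S.measure (Subtype.val '' s) :=
  (MeasurableEmbedding.subtype_coe (measurableSet_domain S)).comap_apply _ _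

namespace IsThinning

variable [Countable G] (H : IsThinning S T κ)

include H

theorem measurableEmbedding_domainLift : MeasurableEmbedding H.domainLift where
  injective p q h := Subtype.ext (H.lift_injective (congrArg Subtype.val h))
  measurable := (H.continuous_lift.measurable.comp measurable_subtype_coe).subtype_mk
  measurableSet_image' s hs := by
    refine ⟨_, H.measurableEmbedding_lift.measurableSet_image.2
      ((measurableSet_domain T).subtype_image hs), ?_⟩
    ext q
    simp only [Set.mem_preimage, Set.mem_image, exists_exists_and_eq_and]
    exact exists_congr fun p => and_congr_right fun _ =>
      ⟨fun h => Subtype.ext h, fun h => congrArg Subtype.val h⟩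

theorem measureIsomorphic (hT : T.domain = Set.univ) {c : ℝ≥0∞}
    (hc : Tendsto (fun n => (T.vol n : ℝ≥0∞) / S.vol (κ n)) atTop (𝓝 c)) (hc' : c ≠ ∞)
    (hc0 : c ≠ 0) : MeasureIsomorphic G S.domainMeasure T.domainMeasure := by
  have hθ := H.measurableEmbedding_domainLift
  -- The isomorphism is the inverse of `domainLift`; only the complement of the range is discarded.
  let φ : Set.range H.domainLift ≃ᵐ (Set.univ : Set T.domain) :=
    hθ.equivRange.symm.trans (MeasurableEquiv.Set.univ _).symm
  have hφ : ∀ (p : T.domain) (h : H.domainLift p ∈ Set.range H.domainLift),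
      (φ ⟨H.domainLift p, h⟩ : T.domain) = p := fun p _ => hθ.equivRange_symm_apply_mk p
  have hinv : ∀ (g : G), ∀ q ∈ Set.range H.domainLift, g • q ∈ Set.range H.domainLift := by
    rintro g _ ⟨p, rfl⟩
    exact ⟨g • p, H.domainLift_smul g p⟩
  refine ⟨Set.range H.domainLift, Set.univ, hinv, φ, c,
    hθ.measurableSet_range, MeasurableSet.univ, ?_, by simp, ?_, hc0, hc', ?_⟩
  · rw [domainMeasure_apply]
    refine measure_mono_null ?_ (H.measure_compl_range_lift hc hc' hc0)
    rintro _ ⟨q, hq, rfl⟩ ⟨p, hp⟩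
    exact hq ⟨⟨p, hT ▸ Set.mem_univ p⟩, Subtype.ext hp⟩
  · rintro g ⟨_, p, rfl⟩
    rw [hφ p ⟨p, rfl⟩, ← hφ (g • p) ⟨g • p, rfl⟩]
    congr 2
    exact Subtype.ext (H.domainLift_smul g p).symm
  · ext E -
    rw [MeasurableEquiv.map_apply, (MeasurableEmbedding.subtype_coe
      hθ.measurableSet_range).comap_apply, Measure.smul_apply, (MeasurableEmbedding.subtype_coe
      MeasurableSet.univ).comap_apply, domainMeasure_apply, domainMeasure_apply, smul_eq_mul,
      ← H.measure_image_lift hc hc']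
    congr 1
    ext q
    constructor
    · rintro ⟨_, ⟨⟨_, p, rfl⟩, hp, rfl⟩, rfl⟩
      exact ⟨p.1, ⟨p, ⟨_, hp, hφ p _⟩, rfl⟩, rfl⟩
    · rintro ⟨_, ⟨_, ⟨p, hp, rfl⟩, rfl⟩, rfl⟩
      refine ⟨_, ⟨⟨H.domainLift p.1, p.1, rfl⟩, ?_, rfl⟩, rfl⟩
      have : φ ⟨H.domainLift p.1, p.1, rfl⟩ = p := Subtype.ext (hφ p.1 _)
      rwa [Set.mem_preimage, this]

end IsThinning

/-! ### From (1-3) to a thinning with (1-2). -/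

theorem EverywhereDefined.domain_eq_univ (hT : T.EverywhereDefined) : T.domain = Set.univ := by
  refine Set.eq_univ_of_forall fun p => Set.mem_iInter.2 fun g => ?_
  obtain ⟨N, hN⟩ := exists_forall_mem_cyl p
  -- Level `N + 1` rather than `N`, because (1-2) speaks of positive levels only.
  obtain ⟨a, ha⟩ := hN (N + 1) N.le_succ
  obtain ⟨k, -, hk⟩ := hT g (N + 1) N.succ_pos
  obtain ⟨d, hd, h1⟩ := exists_mem_cyl_of_le (Nat.le_add_right (N + 1) k) ha
  exact mem_domainOf_iff.2 ⟨_, _, h1, hk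
    ⟨_, mem_prodSet.2 ⟨a, mem_F_of_mem_cyl ha, d, hd, rfl⟩, rfl⟩⟩

theorem two_le_card_block {m n : ℕ} (h : m < n) : 2 ≤ (S.block m n).card := by
  obtain ⟨k, rfl⟩ := Nat.exists_eq_add_of_lt h
  rw [add_assoc, card_block_add]
  calc 2 = 2 ^ 1 := rfl
    _ ≤ 2 ^ (Finset.range (k + 1)).card := Nat.pow_le_pow_right (by omega) (by simp)
    _ ≤ _ := Finset.pow_card_le_prod _ _ _ fun i _ => S.one_lt_card _

open scoped Classical in
-- Choosing a failing `f` for each bad `d` injects the bad `d` into the products `f * d` that `g`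
-- moves out of `F m`. There are `#F n` times as many products as `d`, hence the tolerance `δ / #F
-- n` in (1-3).
theorem AEDefined.eventually_card_bad_le (hS : S.AEDefined) (g : G) {n : ℕ} (hn : 0 < n) {δ : ℝ}
    (hδ : 0 < δ) : ∀ᶠ m in atTop,
      (((S.block n m).filter fun d => ∃ f ∈ S.F n, g * (f * d) ∉ S.F m).card : ℝ) ≤
        δ * (S.block n m).card := by
  have hF : (0 : ℝ) < (S.F n).card := by exact_mod_cast Finset.card_pos.2 (S.nonempty_F n)
  have h1 := (tendsto_order.1 (hS g n hn)).1 (1 - δ / (S.F n).card) (by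
    have := div_pos hδ hF
    linarith)
  obtain ⟨K, hK⟩ := eventually_atTop.1 h1
  refine eventually_atTop.2 ⟨n + K, fun m hm => ?_⟩
  obtain ⟨k, rfl⟩ := Nat.exists_eq_add_of_le (show n ≤ m by omega)
  have h2 := hK k (by omega)
  rw [← card_block_add] at h2
  let P : Finset G := S.F n * S.block n (n + k)
  have hP : ∀ a, a ∈ P ↔ ∃ f ∈ S.F n, ∃ d ∈ S.block n (n + k), f * d = a := fun a =>
    Finset.mem_mul
  have hPcard : P.card = (S.F n).card * (S.block n (n + k)).card := by
    refine Finset.card_mul_iff.2 ?_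
    rintro ⟨f, d⟩ ⟨hf, hd⟩ ⟨f', d'⟩ ⟨hf', hd'⟩ h
    exact Prod.ext_iff.2 (eq_of_mul_block_eq (Nat.le_add_right n k) hf hf' hd hd' h)
  have hgood : (g • S.prodSet n k ∩ (S.F (n + k) : Set G)).ncard =
      (P.filter fun a => g * a ∈ S.F (n + k)).card := by
    rw [← Finset.card_image_of_injective _ (mul_right_injective g), ← Set.ncard_coe_finset]
    congr 1
    ext b
    simp only [Set.mem_inter_iff, Set.mem_smul_set, mem_prodSet, Finset.coe_image,
      Finset.coe_filter, Set.mem_image, Set.mem_ofPred_eq, hP, smul_eq_mul, Finset.mem_coe]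
    constructor
    · rintro ⟨⟨a, ha, rfl⟩, h⟩
      exact ⟨a, ⟨ha, h⟩, rfl⟩
    · rintro ⟨a, ⟨ha, h⟩, rfl⟩
      exact ⟨⟨a, ha, rfl⟩, h⟩
  have hbad : ((S.block n (n + k)).filter fun d => ∃ f ∈ S.F n, g * (f * d) ∉ S.F (n + k)).card ≤
      (P.filter fun a => ¬ g * a ∈ S.F (n + k)).card := by
    have : ∀ d, ∃ f, (∃ f ∈ S.F n, g * (f * d) ∉ S.F (n + k)) →
        f ∈ S.F n ∧ g * (f * d) ∉ S.F (n + k) := fun d => by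
      by_cases h : ∃ f ∈ S.F n, g * (f * d) ∉ S.F (n + k)
      · exact ⟨h.choose, fun _ => h.choose_spec⟩
      · exact ⟨1, fun h' => (h h').elim⟩
    choose f hf using this
    refine Finset.card_le_card_of_injOn (fun d => f d * d) ?_ ?_
    · intro d hd
      simp only [Finset.coe_filter, Set.mem_ofPred_eq] at hd ⊢
      exact ⟨(hP _).2 ⟨_, (hf d hd.2).1, d, hd.1, rfl⟩, (hf d hd.2).2⟩
    · intro d hd d' hd' h
      simp only [Finset.coe_filter, Set.mem_ofPred_eq] at hd hd'
      exact (eq_of_mul_block_eq (Nat.le_add_right n k) (hf d hd.2).1 (hf d' hd'.2).1 hd.1 hd'.1 h).2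
  have hsum := Finset.card_filter_add_card_filter_not (s := P) (fun a => g * a ∈ S.F (n + k))
  have hD : (0 : ℝ) < (S.block n (n + k)).card := by
    have := vol_mul_card_block (S := S) (Nat.le_add_right n k)
    have h3 := S.vol_pos (n + k)
    rw [← this] at h3
    exact_mod_cast Nat.pos_of_mul_pos_left h3
  rw [hgood, Nat.cast_mul, lt_div_iff₀ (mul_pos hF hD), sub_mul, one_mul] at h2
  have h4 : δ / (S.F n).card * ((S.F n).card * (S.block n (n + k)).card) =
      δ * (S.block n (n + k)).card := by
    field_simp
  rw [h4] at h2
  have h5 : ((P.filter fun a => g * a ∈ S.F (n + k)).card : ℝ) +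
      (P.filter fun a => ¬ g * a ∈ S.F (n + k)).card =
      (S.F n).card * (S.block n (n + k)).card := by
    rw [hPcard] at hsum
    exact_mod_cast hsum
  have h6 : (((S.block n (n + k)).filter fun d => ∃ f ∈ S.F n, g * (f * d) ∉ S.F (n + k)).card : ℝ) ≤
      (P.filter fun a => ¬ g * a ∈ S.F (n + k)).card := by exact_mod_cast hbad
  linarith

/-- Most elements of `C (n+1) * ⋯ * C m` move `g F_n` into `F_m`, for all `g` in a given finite
set, if `m` is large. -/
theorem AEDefined.eventually_exists_subset (hS : S.AEDefined) (I : Finset G) {n : ℕ} (hn : 0 < n)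
    {δ : ℝ} (hδ : 0 < δ) : ∀ᶠ m in atTop, ∃ A ⊆ S.block n m,
      (1 - δ) * (S.block n m).card ≤ A.card ∧
      ∀ d ∈ A, ∀ g ∈ I, ∀ f ∈ S.F n, g * (f * d) ∈ S.F m := by
  classical
  -- The tolerance is shared among the elements of `I`; the `+ 1` covers empty `I`.
  have hI : (0 : ℝ) < (I.card : ℝ) + 1 := by positivity
  have h1 : ∀ᶠ m in atTop, ∀ g ∈ I,
      (((S.block n m).filter fun d => ∃ f ∈ S.F n, g * (f * d) ∉ S.F m).card : ℝ) ≤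
        δ / (I.card + 1) * (S.block n m).card :=
    (Filter.eventually_all_finset I).2 fun g _ =>
      hS.eventually_card_bad_le g hn (div_pos hδ hI)
  filter_upwards [h1] with m hm
  let R : Finset G := I.biUnion fun g =>
    (S.block n m).filter fun d => ∃ f ∈ S.F n, g * (f * d) ∉ S.F m
  have hR : R ⊆ S.block n m := Finset.biUnion_subset.2 fun g _ => Finset.filter_subset _ _
  refine ⟨S.block n m \ R, Finset.sdiff_subset, ?_, fun d hd g hg f hf => ?_⟩
  · have h2 : (R.card : ℝ) ≤ I.card * (δ / (I.card + 1) * (S.block n m).card) := by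
      calc (R.card : ℝ) ≤ ∑ g ∈ I, (((S.block n m).filter fun d =>
            ∃ f ∈ S.F n, g * (f * d) ∉ S.F m).card : ℝ) := by exact_mod_cast Finset.card_biUnion_le
        _ ≤ ∑ g ∈ I, δ / (I.card + 1) * (S.block n m).card := Finset.sum_le_sum hm
        _ = _ := by rw [Finset.sum_const, nsmul_eq_mul]
    have h3 : I.card * (δ / (I.card + 1) * (S.block n m).card) ≤ δ * (S.block n m).card := by
      rw [← mul_assoc, mul_div_assoc']
      refine mul_le_mul_of_nonneg_right ?_ (Nat.cast_nonneg _)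
      rw [div_le_iff₀ hI]
      nlinarith
    rw [Finset.cast_card_sdiff hR]
    linarith
  · by_contra h
    obtain ⟨hd1, hd2⟩ := Finset.mem_sdiff.1 hd
    exact hd2 (Finset.mem_biUnion.2 ⟨g, hg, Finset.mem_filter.2 ⟨hd1, f, hf, h⟩⟩)

theorem AEDefined.exists_next (hS : S.AEDefined) (I : Finset G) {δ : ℝ} (hδ : 0 < δ)
    (hδ' : δ ≤ 1 / 4) (n : ℕ) : ∃ m, n < m ∧ ∃ A ⊆ S.block n m, 1 < A.card ∧
      (1 - δ) * (S.block n m).card ≤ A.card ∧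
      (0 < n → ∀ d ∈ A, ∀ g ∈ I, ∀ f ∈ S.F n, g * (f * d) ∈ S.F m) := by
  rcases n.eq_zero_or_pos with rfl | hn
  -- (1-3) says nothing at level `0`, so the whole block is kept there.
  · refine ⟨1, one_pos, S.block 0 1, subset_rfl, two_le_card_block one_pos, ?_, by simp⟩
    nlinarith [(Nat.cast_nonneg (S.block 0 1).card : (0 : ℝ) ≤ _)]
  · obtain ⟨m, ⟨A, hA, hcard, hgood⟩, hm⟩ :=
      ((hS.eventually_exists_subset I hn hδ).and (eventually_gt_atTop n)).exists
    refine ⟨m, hm, A, hA, ?_, hcard, fun _ => hgood⟩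
    have h2 : (2 : ℝ) ≤ (S.block n m).card := by exact_mod_cast two_le_card_block hm
    -- At least `3/4` of a block with at least two elements is kept.
    have h3 : (1 : ℝ) < A.card := by nlinarith
    exact_mod_cast h3

/-- If the proportions of the sets retained in a thinning converge to `1` fast enough, then the
product of these proportions is positive. -/
theorem IsThinning.exists_tendsto (H : IsThinning S T κ) (hκ : κ 0 = 0)
    (hcard : ∀ n, (1 - 1 / 2 ^ (n + 2)) * ((S.block (κ n) (κ (n + 1))).card : ℝ) ≤
      (T.C (n + 1)).card) :
    ∃ c : ℝ≥0∞, c ≠ 0 ∧ c ≠ ∞ ∧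
      Tendsto (fun n => (T.vol n : ℝ≥0∞) / S.vol (κ n)) atTop (𝓝 c) := by
  have hpos : ∀ n, (0 : ℝ) < S.vol (κ n) := fun n => by exact_mod_cast S.vol_pos _
  have hblock : ∀ n, (S.vol (κ (n + 1)) : ℝ) =
      S.vol (κ n) * (S.block (κ n) (κ (n + 1))).card := fun n => by
    exact_mod_cast (vol_mul_card_block (H.mono n.le_succ)).symm
  have hvol : ∀ n, (T.vol (n + 1) : ℝ) = T.vol n * (T.C (n + 1)).card := fun n => by
    exact_mod_cast vol_succ n
  let r : ℕ → ℝ := fun n => T.vol n / S.vol (κ n)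
  have hanti : Antitone r := by
    refine antitone_nat_of_succ_le fun n => ?_
    simp only [r]
    have hsub : ((T.C (n + 1)).card : ℝ) ≤ (S.block (κ n) (κ (n + 1))).card := by
      exact_mod_cast Finset.card_le_card (H.C_subset n)
    rw [div_le_div_iff₀ (hpos _) (hpos _), hblock, hvol, mul_assoc, mul_comm (S.vol (κ n) : ℝ)]
    gcongr
  -- The explicit bound survives induction: with `t = 1 / 2 ^ (n+1) ≤ 1/2` one has `(1/2 + t) (1 -
  -- t/2) ≥ 1/2 + t/2`.
  have hlow : ∀ n, 1 / 2 + 1 / 2 ^ (n + 1) ≤ r n := fun n => by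
    induction n with
    | zero => simp [r, hκ, vol]; norm_num
    | succ n ih =>
      simp only [r] at ih ⊢
      rw [le_div_iff₀ (hpos _)] at ih ⊢
      rw [hblock, hvol]
      have ht : (1 : ℝ) / 2 ^ (n + 1) ≤ 1 / 2 := by
        rw [pow_succ]
        have : (1 : ℝ) ≤ 2 ^ n := one_le_pow₀ (by norm_num)
        rw [div_le_div_iff₀ (by positivity) (by norm_num)]
        linarith
      have ht0 : (0 : ℝ) < 1 / 2 ^ (n + 1) := by positivity
      have hc := hcard n
      have e1 : (1 : ℝ) / 2 ^ (n + 2) = 1 / 2 ^ (n + 1) / 2 := by rw [pow_succ _ (n + 1)]; field_simp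
      rw [e1] at hc
      rw [show n + 1 + 1 = n + 2 from rfl, e1]
      generalize (1 : ℝ) / 2 ^ (n + 1) = t at *
      have hD : (0 : ℝ) ≤ (S.block (κ n) (κ (n + 1))).card := Nat.cast_nonneg _
      calc (1 / 2 + t / 2) * (S.vol (κ n) * ((S.block (κ n) (κ (n + 1))).card : ℝ))
          ≤ ((1 / 2 + t) * (1 - t / 2)) *
            (S.vol (κ n) * ((S.block (κ n) (κ (n + 1))).card : ℝ)) := by
            refine mul_le_mul_of_nonneg_right ?_ (mul_nonneg (hpos n).le hD)
            nlinarith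
        _ = ((1 / 2 + t) * S.vol (κ n)) *
            ((1 - t / 2) * ((S.block (κ n) (κ (n + 1))).card : ℝ)) := by ring
        _ ≤ _ := mul_le_mul ih hc (mul_nonneg (by linarith) hD) (Nat.cast_nonneg _)
  have hhalf : ∀ n, 1 / 2 ≤ r n := fun n =>
    (le_add_of_nonneg_right (by positivity)).trans (hlow n)
  have hlim := tendsto_atTop_ciInf hanti ⟨1 / 2, by rintro _ ⟨n, rfl⟩; exact hhalf n⟩
  have hge : 1 / 2 ≤ ⨅ n, r n := le_ciInf hhalf
  refine ⟨ENNReal.ofReal (⨅ n, r n), ?_, ENNReal.ofReal_ne_top, ?_⟩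
  · rw [Ne, ENNReal.ofReal_eq_zero, not_le]
    linarith
  · have := ENNReal.tendsto_ofReal hlim
    simpa only [r, ENNReal.ofReal_div_of_pos (hpos _), ENNReal.ofReal_natCast] using this

theorem AEDefined.exists_isThinning [Countable G] (hS : S.AEDefined) :
    ∃ (T : CFSequence G) (κ : ℕ → ℕ), IsThinning S T κ ∧ T.EverywhereDefined ∧
      ∃ c : ℝ≥0∞, c ≠ 0 ∧ c ≠ ∞ ∧
        Tendsto (fun n => (T.vol n : ℝ≥0∞) / S.vol (κ n)) atTop (𝓝 c) := by
  classical
  obtain ⟨γ, hγ⟩ := exists_surjective_nat G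
  -- Here `i` is the step and `n` the level reached; step `i` takes care of `γ 0, …, γ i`.
  have hstep : ∀ i n, ∃ m, n < m ∧ ∃ A ⊆ S.block n m, 1 < A.card ∧
      (1 - 1 / 2 ^ (i + 2)) * ((S.block n m).card : ℝ) ≤ A.card ∧
      (0 < n → ∀ d ∈ A, ∀ g ∈ (Finset.range (i + 1)).image γ, ∀ f ∈ S.F n,
        g * (f * d) ∈ S.F m) := fun i n => by
    refine hS.exists_next _ (by positivity) ?_ n
    rw [div_le_div_iff₀ (by positivity) (by norm_num), pow_add]
    have : (1 : ℝ) ≤ 2 ^ i := one_le_pow₀ (by norm_num)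
    linarith
  choose next hnext A hA hcard hprop hgood using hstep
  let κ : ℕ → ℕ := fun n => Nat.rec 0 next n
  have hκ : StrictMono κ := strictMono_nat_of_lt_succ fun n => hnext n (κ n)
  let T : CFSequence G :=
    { F := fun n => S.F (κ n)
      -- The shift makes `C (n+1)` the set chosen at step `n`; the value at `0` is irrelevant.
      C := fun n => A (n - 1) (κ (n - 1))
      F_zero := S.F_zero
      one_lt_card := fun n => hcard n (κ n)
      mul_subset := fun n => by
        rintro _ ⟨a, ha, d, hd, rfl⟩
        exact mul_block_mem_F (hnext n (κ n)).le ha (hA n (κ n) hd)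
      disjoint := fun n c hc c' hc' hne => by
        rw [Set.disjoint_left]
        rintro _ ⟨a, ha, _, rfl, rfl⟩ ⟨b, hb, _, rfl, h⟩
        exact hne (eq_of_mul_block_eq (hnext n (κ n)).le hb ha (hA n (κ n) hc') (hA n (κ n) hc)
          h).2.symm }
  have H : IsThinning S T κ := ⟨hκ, fun n => rfl, fun n => hA n (κ n)⟩
  refine ⟨T, κ, H, fun g n hn => ?_, H.exists_tendsto rfl fun n => hprop n (κ n)⟩
  obtain ⟨i, rfl⟩ := hγ g
  -- Step `m` comes late enough to include `γ i`. The factors before the last keep `F'_n` inside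
  -- `F'_m`, and the last one absorbs `γ i`.
  let m := max n i
  have hnm : n ≤ m := le_max_left _ _
  refine ⟨m + 1 - n, by omega, ?_⟩
  rintro _ ⟨a, ha, rfl⟩
  obtain ⟨f, hf, d, hd, rfl⟩ := mem_prodSet.1 ha
  rw [show n + (m + 1 - n) = m + 1 by omega] at hd ⊢
  obtain ⟨d, hd', c, hc, rfl⟩ := (mem_block_succ hnm).1 hd
  change γ i * (f * (d * c)) ∈ S.F (κ (m + 1))
  rw [← mul_assoc f]
  -- The step from level `0` carries no information about translates.
  have hm : 0 < κ m := (hn.trans_le hnm).trans_le hκ.le_apply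
  exact hgood m (κ m) hm c hc (γ i)
    (Finset.mem_image_of_mem γ (Finset.mem_range.2 (Nat.lt_succ_of_le (le_max_right _ _))))
    (f * d) (mul_block_mem_F hnm hf hd')

end CFSequence

open CFSequence in
theorem theorem1p8 {G : Type*} [Group G] [Countable G] [Infinite G] (S : CFSequence G)
    (hS : S.AEDefined) :
    S.measure S.domainᶜ = 0 ∧
    ∃ S' : CFSequence G, S'.EverywhereDefined ∧ S'.domain = Set.univ ∧
      (∃ k : ℕ → ℕ, StrictMono k ∧ ∀ n, S'.F n = S.F (k n)) ∧
      MeasureIsomorphic G S.domainMeasure S'.domainMeasure ∧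
      ∀ e : Multiplicative ℤ ≃* G,
        IsRankOne e S.domainMeasure → IsRankOne e S'.domainMeasure := by
  obtain ⟨T, κ, H, hT, c, hc0, hc', hc⟩ := hS.exists_isThinning
  have hdom := hT.domain_eq_univ
  have hiso := H.measureIsomorphic hdom hc hc' hc0
  refine ⟨?_, T, hT, hdom, ⟨κ, H.strictMono, H.F_eq⟩, hiso, fun e he =>
    he.of_measureIsomorphic hiso⟩
  -- The conull range of `lift` lies in `X^G`, since every point of the new space is in the domain
  -- of its action.
  refine measure_mono_null (Set.compl_subset_compl.2 ?_) (H.measure_compl_range_lift hc hc' hc0)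
  rintro _ ⟨p, rfl⟩
  exact H.lift_mem_domain (hdom ▸ Set.mem_univ p)
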